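/- **Theorem (Distributional Value Iteration).** *Setting.* Let $\mathcal C=\mathbb R^m$, let $\mathcal S$ be a measurable state space, $\mathcal A$ a finite action set and $\gamma\in(0,1]$. In an MDP, taking action $a$ in state $s$ with stock $c\in\mathcal C$ produces a random pair (reward, next state) $(R',S')\in\mathcal C\times\mathcal S$ with law $P(\cdot\mid s,c,a)$, where $P$ is a probability kernel ($P$ may or may not depend on $c$), and the next stock is $C'=\gamma^{-1}(c+R')$. Assume $\sup_{s,c,a}\mathbb E[\|R'\|_1\mid s,c,a]<\infty$. A state $s$ is terminal if $(S',R')=(s,0)$ almost surely for every $c$ and $a$. The MDP has finite horizon if for some $n\ge1$ the state $S_n$ is terminal almost surely for every policy and every initial $(s,c)$; the least such $n$ is the horizon. Policies are measurable. $\Pi$ is the set of stationary policies $\mathcal S\times\mathcal C\to\Delta(\mathcal A)$, $\Pi_{\mathrm M}$ the set of sequences of elements of $\Pi$ (Markov policies), and $\Pi_{\mathrm H}$ the set of policies depending on the whole history $(S_0,C_0),A_0,R_1,(S_1,C_1),\dots,(S_t,C_t)$. Let $\eta^\pi(s,c)$ be the law of $\sum_{t\ge0}\gamma^tR_{t+1}$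 under $\pi$ started at $(s,c)$. Let $\mathrm w$ be the 1-Wasserstein distance for $\|\cdot\|_1$ between probability distributions on $\mathcal C$, $(\mathcal D,\mathrm w)$ the set of such $\nu$ with $\mathrm w(\nu,\delta_0)<\infty$, $\overline{\mathrm w}(\eta,\eta')=\sup_{s,c}\mathrm w(\eta(s,c),\eta'(s,c))$ for measurable families indexed by $\mathcal S\times\mathcal C$, and $(\mathcal D^{\mathcal S\times\mathcal C},\overline{\mathrm w})$ the set of families $\eta$ with $\overline{\mathrm w}(\eta,\delta_0)<\infty$. For $\pi\in\Pi$ let $(T_\pi\eta)(s,c)$ be the law of $R'+\gamma G$, where $A\sim\pi(s,c)$, $(R',S')\sim P(\cdot\mid s,c,A)$, $C'=\gamma^{-1}(c+R')$, $G\sim\eta(S',C')$, except that $(T_\pi\eta)(s,c)=\delta_0$ if $s$ is terminal. Let $K:(\mathcal D,\mathrm w)\to\mathbb R$ and $(F_K\eta)(s,c)=K(\text{law of }c+G)$ with $G\sim\eta(s,c)$. $K$ is *indifferent to mixtures* if, whenever $\eta,\eta'\in(\mathcal D^{\mathcal S\times\mathcal C},\overline{\mathrm w})$ satisfy $K\eta(s,c)\ge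 K\eta'(s,c)$ for all $(s,c)$, then $K(\int\eta\,d\lambda)\ge K(\int\eta'\,d\lambda)$ for every probability measure $\lambda$ on $\mathcal S\times\mathcal C$. $K$ is *indifferent to $\gamma$* if $K\nu\ge K\nu'$ implies $K(\text{law of }\gamma G)\ge K(\text{law of }\gamma G')$, where $G\sim\nu$, $G'\sim\nu'$, for all $\nu,\nu'\in(\mathcal D,\mathrm w)$. $K$ is *$L$-Lipschitz* if $|K\nu-K\nu'|\le L\,\mathrm w(\nu,\nu')$ for all $\nu,\nu'\in(\mathcal D,\mathrm w)$. *Claim.* Let $K$ be indifferent to mixtures and indifferent to $\gamma$. Let $\eta_0,\eta_1,\dots\in(\mathcal D^{\mathcal S\times\mathcal C},\overline{\mathrm w})$ and $\overline\pi_0,\overline\pi_1,\dots\in\Pi$ satisfy, for all $n\ge0$ (pointwise in $(s,c)$), $$F_K\eta_{n+1}=\sup_{\pi\in\Pi}F_KT_\pi\eta_n,\qquad F_KT_{\overline\pi_n}\eta_n=\sup_{\pi\in\Pi}F_KT_\pi\eta_n .$$ Then the following hold, all relations between functions being pointwise in $(s,c)$. *Finite-horizon case.* If the MDP has horizon $N$,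 then $\sup_{\pi\in\Pi_{\mathrm H}}\overline{\mathrm w}(\eta^\pi,\delta_0)<\infty$ and for all $n\ge N$ $$F_K\eta_n=\sup_{\pi\in\Pi_{\mathrm H}}F_K\eta^\pi,\qquad F_K\eta^{\overline\pi_n}=\sup_{\pi\in\Pi_{\mathrm H}}F_K\eta^\pi,$$ where, in the single case $n=N$, the first equality is claimed under the condition that $\eta_0(s,c)=\delta_0$ for every terminal $s$ and every $c$. *Discounted case.* If $\gamma<1$ and $K$ is $L$-Lipschitz, then $\sup_{\pi\in\Pi_{\mathrm H}}\overline{\mathrm w}(\eta^\pi,\delta_0)<\infty$, the suprema on the right-hand sides below and $\sup_{\pi\in\Pi_{\mathrm H}}F_K\eta^\pi$ are finite, and for all $n\ge0$ $$\sup_{\pi\in\Pi_{\mathrm H}}F_K\eta^\pi-F_K\eta_n\le L\gamma^n\sup_{\pi\in\Pi_{\mathrm M}}\overline{\mathrm w}(\eta_0,\eta^\pi),$$ $$\sup_{\pi\in\Pi_{\mathrm H}}F_K\eta^\pi-F_K\eta^{\overline\pi_n}\le L\gamma^n\Big(\frac1{1-\gamma}\sup_{\pi\in\Pi}\overline{\mathrm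 w}(T_\pi\eta_0,\eta_0)+\sup_{\pi\in\Pi_{\mathrm M}}\overline{\mathrm w}(\eta_0,\eta^\pi)\Big).$$ -/

import Mathlib

open MeasureTheory ProbabilityTheory Set
open scoped ENNReal

namespace DistDP

noncomputable section

/-! ### Distributions on `ℝᵐ` with the 1-Wasserstein distance -/

/-- The space `𝒞 = ℝᵐ` of rewards, returns and stocks. -/
abbrev Vec (m : ℕ) : Type := Fin m → ℝ

/-- The `ℓ¹` norm on `ℝᵐ`, with values in `[0, ∞]`. -/
def l1 {m : ℕ} (x : Vec m) : ℝ≥0∞ := ∑ i, ‖x i‖ₑ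

/-- The 1-Wasserstein distance for the `ℓ¹` norm: the infimum of `𝔼 ‖X - X'‖₁` over all couplings
`(X, X')` of `μ` and `ν`, with values in `[0, ∞]`. -/
def wass {m : ℕ} (μ ν : Measure (Vec m)) : ℝ≥0∞ :=
  ⨅ (ρ : Measure (Vec m × Vec m)) (_ : ρ.map Prod.fst = μ) (_ : ρ.map Prod.snd = ν),
    ∫⁻ z, l1 (z.1 - z.2) ∂ρ

/-- Membership in `(𝒟, w)`: probability distributions at finite Wasserstein distance from `δ₀`. -/
def InP1 {m : ℕ} (ν : Measure (Vec m)) : Prop :=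
  IsProbabilityMeasure ν ∧ wass ν (Measure.dirac 0) < ⊤

/-- The space `(𝒟, w)`. -/
def P1 (m : ℕ) : Type := {ν : Measure (Vec m) // InP1 ν}

open Classical in
/-- The value `K ν` of a functional `K : (𝒟, w) → ℝ` at a measure `ν`. It is only meaningful for
`ν` in `(𝒟, w)`; the value `0` elsewhere is a placeholder. -/
def ev {m : ℕ} (K : P1 m → ℝ) (ν : Measure (Vec m)) : ℝ :=
  if h : InP1 ν then K ⟨ν, h⟩ else 0

/-- The supremum 1-Wasserstein distance between families of distributions. -/
def wassSup {X : Type*} {m : ℕ} (η η' : X → Measure (Vec m)) : ℝ≥0∞ :=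
  ⨆ x, wass (η x) (η' x)

/-- The family constantly equal to `δ₀`. -/
def zeroDist (X : Type*) (m : ℕ) : X → Measure (Vec m) := fun _ => Measure.dirac 0

/-- Return distribution functions: the space `(𝒟^{S × 𝒞}, w̄)` of (measurable) families of
distributions indexed by augmented states, at finite supremum distance from `δ₀`. -/
structure RetDist (S : Type*) [MeasurableSpace S] (m : ℕ) where
  ker : Kernel (S × Vec m) (Vec m)
  markov : IsMarkovKernel ker
  bounded : wassSup ker (zeroDist (S × Vec m) m) < ⊤

attribute [instance] RetDist.markov

/-- The stock-augmented objective functional `(F_K η)(s, c) = K (df (c + G(s, c)))`, where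
`G(s, c) ∼ η (s, c)`. -/
def objective {S : Type*} {m : ℕ} (K : P1 m → ℝ) (η : S × Vec m → Measure (Vec m))
    (x : S × Vec m) : ℝ :=
  ev K ((η x).map (fun g => x.2 + g))

/-- `K` is indifferent to mixtures (of initial augmented states in `S × ℝᵐ`). The random index
`(S, C)` has law `lam`, so that `G(S, C)` has law `lam.bind η`. -/
def IndifferentToMixtures (S : Type*) [MeasurableSpace S] {m : ℕ} (K : P1 m → ℝ) : Prop :=
  ∀ η η' : RetDist S m, (∀ x, ev K (η'.ker x) ≤ ev K (η.ker x)) →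
    ∀ lam : Measure (S × Vec m), IsProbabilityMeasure lam →
      ev K (lam.bind η'.ker) ≤ ev K (lam.bind η.ker)

/-- `K` is indifferent to `γ`. -/
def IndifferentToDiscount {m : ℕ} (γ : ℝ) (K : P1 m → ℝ) : Prop :=
  ∀ ν ν' : P1 m, K ν' ≤ K ν →
    ev K (ν'.1.map (fun g => γ • g)) ≤ ev K (ν.1.map (fun g => γ • g))

/-- `K` is `L`-Lipschitz with respect to the 1-Wasserstein distance. -/
def LipschitzFunctional {m : ℕ} (L : ℝ) (K : P1 m → ℝ) : Prop :=
  ∀ ν ν' : P1 m, |K ν - K ν'| ≤ L * (wass ν.1 ν'.1).toReal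

/-! ### Stock-augmented Markov decision processes -/

/-- A Markov decision process with states `S`, actions `A`, rewards in `ℝᵐ` and discount `γ`,
whose rewards have uniformly bounded first moment. `P ((s, c), a)` is the joint law of
`(R_{t+1}, S_{t+1})` given `S_t = s`, `C_t = c`, `A_t = a`. Dependence on the stock `c` is allowed;
an ordinary MDP is the case where `P` ignores `c`. -/
structure MDP (S A : Type*) [MeasurableSpace S] [MeasurableSpace A] (m : ℕ) where
  γ : ℝ
  γ_pos : 0 < γ
  γ_le_one : γ ≤ 1
  P : Kernel ((S × Vec m) × A) (Vec m × S)
  markov : IsMarkovKernel P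
  reward_bounded : (⨆ z, ∫⁻ y, l1 y.1 ∂(P z)) < ⊤
  /-- The set of terminal states is measurable. -/
  measurableSet_terminal :
    MeasurableSet {s : S | ∀ (c : Vec m) (a : A), P ((s, c), a) = Measure.dirac (0, s)}

attribute [instance] MDP.markov

/-- What is observed after an action is taken: `(A_t, (R_{t+1}, (S_{t+1}, C_{t+1})))`. -/
abbrev Step (S A : Type*) (m : ℕ) : Type _ := A × (Vec m × (S × Vec m))

/-- Histories `(S₀, C₀), A₀, R₁, (S₁, C₁), …, A_{n-1}, R_n, (S_n, C_n)`. -/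
abbrev Hist (S A : Type*) (m n : ℕ) : Type _ := (S × Vec m) × (Fin n → Step S A m)

/-- The last augmented state `(S_n, C_n)` of a history. -/
def Hist.last {S A : Type*} {m : ℕ} : {n : ℕ} → Hist S A m n → S × Vec m
  | 0, h => h.1
  | n + 1, h => (h.2 (Fin.last n)).2.2

theorem Hist.measurable_last {S A : Type*} [MeasurableSpace S] [MeasurableSpace A] {m : ℕ} :
    ∀ {n : ℕ}, Measurable (Hist.last : Hist S A m n → S × Vec m)
  | 0 => measurable_fst
  | n + 1 => by
    have h : Measurable (fun h : Hist S A m (n + 1) => (h.2 (Fin.last n)).2.2) := by fun_prop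
    exact h

/-- Stationary Markov policies with respect to the augmented state: the set `Π`. -/
structure StatPolicy (S A : Type*) [MeasurableSpace S] [MeasurableSpace A] (m : ℕ) where
  act : Kernel (S × Vec m) A
  markov : IsMarkovKernel act

attribute [instance] StatPolicy.markov

/-- Markov policies: sequences `π₀, π₁, …` of stationary policies, the set `Π_M`. -/
abbrev MarkovPolicy (S A : Type*) [MeasurableSpace S] [MeasurableSpace A] (m : ℕ) : Type _ :=
  ℕ → StatPolicy S A m

/-- History-based policies: the set `Π_H`. -/
structure HistPolicy (S A : Type*) [MeasurableSpace S] [MeasurableSpace A] (m : ℕ) where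
  act : (n : ℕ) → Kernel (Hist S A m n) A
  markov : ∀ n, IsMarkovKernel (act n)

attribute [instance] HistPolicy.markov

/-- A Markov policy as a history-based policy: `A_t ∼ π_t(S_t, C_t)`. -/
def MarkovPolicy.toHist {S A : Type*} [MeasurableSpace S] [MeasurableSpace A] {m : ℕ}
    (π : MarkovPolicy S A m) : HistPolicy S A m where
  act n := (π n).act.comap Hist.last Hist.measurable_last
  markov _ := inferInstance

/-- A stationary policy as a history-based policy: `A_t ∼ π(S_t, C_t)`. -/
def StatPolicy.toHist {S A : Type*} [MeasurableSpace S] [MeasurableSpace A] {m : ℕ}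
    (π : StatPolicy S A m) : HistPolicy S A m :=
  MarkovPolicy.toHist (fun _ => π)

namespace MDP

variable {S A : Type*} [MeasurableSpace S] [MeasurableSpace A] {m : ℕ}

/-- A state `s` is terminal if `(S_{t+1}, R_{t+1}) = (s, 0)` with probability one whenever
`S_t = s`. -/
def IsTerminal (M : MDP S A m) (s : S) : Prop :=
  ∀ (c : Vec m) (a : A), M.P ((s, c), a) = Measure.dirac (0, s)

/-- The transition kernel of the augmented MDP, from `((s, c), a)` to `(r', (s', c'))` with
`c' = γ⁻¹ (c + r')`. -/
def aug (M : MDP S A m) : Kernel ((S × Vec m) × A) (Vec m × (S × Vec m)) :=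
  (Kernel.id ×ₖ M.P).map
    (fun p => (p.2.1, (p.2.2, M.γ⁻¹ • (p.1.1.2 + p.2.1))))

theorem measurable_aug (M : MDP S A m) :
    Measurable (fun p : ((S × Vec m) × A) × (Vec m × S) =>
      (p.2.1, (p.2.2, M.γ⁻¹ • (p.1.1.2 + p.2.1)))) := by
  fun_prop

instance (M : MDP S A m) : IsMarkovKernel M.aug :=
  Kernel.IsMarkovKernel.map _ M.measurable_aug

/-- The law of `(A_n, R_{n+1}, (S_{n+1}, C_{n+1}))` given the history up to time `n`, under a
history-based policy. -/
def stepKernel (M : MDP S A m) (π : HistPolicy S A m) (n : ℕ) :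
    Kernel (Hist S A m n) (Step S A m) :=
  π.act n ⊗ₖ M.aug.comap (fun p : Hist S A m n × A => (p.1.last, p.2))
    ((Hist.measurable_last.comp measurable_fst).prodMk measurable_snd)

instance (M : MDP S A m) (π : HistPolicy S A m) (n : ℕ) : IsMarkovKernel (M.stepKernel π n) := by
  unfold stepKernel; infer_instance

/-- The history formed by the initial augmented state `x` and the steps `0, …, n`. -/
def toHistory (x : S × Vec m) (n : ℕ) (h : (i : Finset.Iic n) → Step S A m) :
    Hist S A m (n + 1) :=
  (x, fun i => h ⟨i, Finset.mem_Iic.2 (Nat.lt_succ_iff.1 i.2)⟩)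

theorem measurable_toHistory (x : S × Vec m) (n : ℕ) :
    Measurable (toHistory (A := A) x n) := by
  unfold toHistory; fun_prop

/-- The law of the trajectory `(A_t, R_{t+1}, (S_{t+1}, C_{t+1}))_{t ≥ 0}` generated by a
history-based policy from the initial augmented state `(S₀, C₀) = x`. -/
def trajLaw (M : MDP S A m) (π : HistPolicy S A m) (x : S × Vec m) :
    Measure (ℕ → Step S A m) :=
  Kernel.trajMeasure (X := fun _ => Step S A m) (M.stepKernel π 0 (x, Fin.elim0))
    (fun n => (M.stepKernel π (n + 1)).comap (toHistory x n) (measurable_toHistory x n))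

/-- The augmented state `(S_n, C_n)` along a trajectory started in `x`. -/
def stateAt (x : S × Vec m) (ω : ℕ → Step S A m) : ℕ → S × Vec m
  | 0 => x
  | n + 1 => (ω n).2.2

/-- The discounted return `∑_{t ≥ 0} γ^t R_{t+1}` of a trajectory. -/
def discountedReturn (M : MDP S A m) (ω : ℕ → Step S A m) : Vec m :=
  ∑' t, M.γ ^ t • (ω t).2.1

/-- The return distribution function `η^π` of a history-based policy. -/
def retDist (M : MDP S A m) (π : HistPolicy S A m) (x : S × Vec m) : Measure (Vec m) :=
  (M.trajLaw π x).map M.discountedReturn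

/-- `S_n` is terminal with probability one, along every trajectory of the MDP. -/
def TerminatesBy (M : MDP S A m) (n : ℕ) : Prop :=
  ∀ (π : HistPolicy S A m) (x : S × Vec m),
    ∀ᵐ ω ∂(M.trajLaw π x), M.IsTerminal (stateAt x ω n).1

/-- The MDP has finite horizon, equal to `N`: the smallest `n ≥ 1` such that `S_n` is always
terminal. -/
def HasHorizon (M : MDP S A m) (N : ℕ) : Prop :=
  IsLeast {n : ℕ | 1 ≤ n ∧ M.TerminatesBy n} N

open Classical in
/-- The stock-augmented distributional Bellman operator `T_π`: `(T_π η)(s, c)` is the law of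
`R_{t+1} + γ G(S_{t+1}, C_{t+1})`, with `G(s', c') ∼ η (s', c')`, given `(S_t, C_t) = (s, c)` and
`A_t ∼ π(s, c)`; it is `δ₀` when `s` is terminal. -/
def bellman (M : MDP S A m) (π : StatPolicy S A m) (η : RetDist S m) :
    Kernel (S × Vec m) (Vec m) :=
  Kernel.piecewise (s := {x : S × Vec m | M.IsTerminal x.1})
    (measurable_fst M.measurableSet_terminal)
    (Kernel.const _ (Measure.dirac 0))
    (((π.act ⊗ₖ M.aug) ⊗ₖ
        η.ker.comap (fun p : (S × Vec m) × Step S A m => p.2.2.2) (by fun_prop)).map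
      (fun q => q.1.2.1 + M.γ • q.2))

end MDP

end

end DistDP

/-!
Why value iteration works here. The stock `C` absorbs the rewards: since `C' = γ⁻¹ (c + R')`,
`c + R' + γ G(S', C') = γ (C' + G(S', C'))`. So `c` plus the return of one step followed by `ζ` is
`γ` times a mixture, over the next augmented state, of the laws of `C' + G(S', C')`
(`MDP.shift_bellman`). Indifference to mixtures and to `γ` then makes the Bellman operators
monotone with respect to the objective `F_K` (`MDP.objective_bellman_le`), and dynamic programming
applies: composing Bellman operators along any Markov policy never beats the iterates of `η`, and
the greedy policies in reverse order attain them (`ValueIteration.objective_iter_le`,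
`ValueIteration.objective_iter_eq`).

Two points need more than this. First, the family of laws of `C + G` has unbounded moments, while
indifference to mixtures only speaks of bounded families. A mixture with integrable moments can be
rebalanced: components of large moment are diluted by the average of the other components and given
a proportionally larger weight. The diluted family is bounded and has the same mixture
(`bind_rebalanced`, `IndifferentToMixtures.bind_le`). Second, iterating the stock equation gives
`c + ∑_{t < n} γ ^ t R_{t+1} = γ ^ n C_n`, so the law of the return depends only on the laws of the
augmented states `(S_n, C_n)`. Drawing each action from its conditional law given the current
augmented state, a Markov policy generates the same laws as a given history-based policy
(`MDP.exists_markovPolicy_map_stateAt_eq`). Hence only Markov policies have to be considered.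

With horizon `N`, the return distribution is the `N`-fold composition of Bellman operators applied
to any family that vanishes at terminal states (`MDP.TerminatesBy.objective_retDist_eq`). At the
horizon itself the greedy policy is optimal whatever `η 0` is at terminal states, because after one
step only `N - 1` steps remain (`MDP.TerminatesBy.le_objective_bellman_horizon`).

In the discounted case the Bellman operators contract the supremum Wasserstein distance by `γ`
(`MDP.wass_bellman_le`), so the composition of `n` operators applied to `η 0` is within
`γ ^ n sup w̄(η 0, η^π)` of the return distribution (`MDP.wass_iter_retDist_le`), and a telescoping
sum bounds the loss of the greedy policy (`MDP.objective_le_objective_greedy`). The contraction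
rests on the convexity of the Wasserstein distance under mixtures (`wass_bind_le`). It follows from
Kantorovich–Rubinstein duality (`wass_le_of_forall_isL1Lip`), which is reduced by quantisation to
finitely many points, where it is a Hahn–Banach argument (`exists_finite_coupling`).
-/

namespace DistDP

/-! ### Finite optimal transport -/

/-- The values of the dual programme whose infimum is the sublinear functional of the Hahn–Banach
argument in `exists_finite_coupling`: `φ ⊕ ψ + t • d` has to dominate `h`, at the price
`∑ φ p + ∑ ψ q + t D`. -/
def dualValues {ι : Type*} [Fintype ι] (d : ι → ι → ℝ) (p q : ι → ℝ) (D : ℝ) (h : ι × ι → ℝ) :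
    Set ℝ :=
  {r | ∃ (φ ψ : ι → ℝ) (t : ℝ), 0 ≤ t ∧ (∀ i j, h (i, j) ≤ φ i + ψ j + t * d i j) ∧
    r = ∑ i, φ i * p i + ∑ j, ψ j * q j + t * D}

section FiniteTransport

variable {ι : Type*} [Fintype ι] {d : ι → ι → ℝ} {p q : ι → ℝ} {D : ℝ}

theorem dualValues_lower_bound (hp : ∑ i, p i = 1)
    (hD : ∀ φ ψ : ι → ℝ, (∀ i j, φ i + ψ j ≤ d i j) →
      ∑ i, φ i * p i + ∑ j, ψ j * q j ≤ D)
    (hp0 : ∀ i, 0 ≤ p i) (hq0 : ∀ i, 0 ≤ q i) (hq : ∑ i, q i = 1)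
    {h : ι × ι → ℝ} {b : ℝ} (hb : ∀ z, -b ≤ h z) {r : ℝ} (hr : r ∈ dualValues d p q D h) :
    -b ≤ r := by
  obtain ⟨φ, ψ, t, ht, hdom, rfl⟩ := hr
  rcases ht.eq_or_lt with rfl | ht
  · -- without the `d` term, integrate `φ ⊕ ψ ≥ -b` against the product weights
    have h1 : ∑ i, ∑ j, (φ i + ψ j) * (p i * q j) = ∑ i, φ i * p i + ∑ j, ψ j * q j := by
      have e1 : ∀ i j, (φ i + ψ j) * (p i * q j) = φ i * p i * q j + p i * (ψ j * q j) := by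
        intros; ring
      simp only [e1, Finset.sum_add_distrib, ← Finset.mul_sum, hq, mul_one, ← Finset.sum_mul, hp,
        one_mul]
    have h2 : ∑ i, ∑ j, (-b) * (p i * q j) = -b := by
      simp only [← Finset.mul_sum, hq, mul_one, hp]
    have h3 : ∑ i, ∑ j, (-b) * (p i * q j) ≤ ∑ i, ∑ j, (φ i + ψ j) * (p i * q j) := by
      refine Finset.sum_le_sum fun i _ => Finset.sum_le_sum fun j _ => ?_
      refine mul_le_mul_of_nonneg_right ?_ (mul_nonneg (hp0 i) (hq0 j))
      have := hdom i j; have := hb (i, j); linarith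
    linarith
  · have h1 := hD (fun i => (-φ i - b) / t) (fun j => -ψ j / t) (fun i j => by
      rw [← add_div, div_le_iff₀ ht]
      have := hdom i j; have := hb (i, j); linarith)
    have h2 : ∑ i, (-φ i - b) / t * p i = (-∑ i, φ i * p i - b) / t := by
      have e : ∀ i, (-φ i - b) / t * p i = t⁻¹ * (-(φ i * p i)) - t⁻¹ * b * p i := by
        intro i; ring
      simp only [e, Finset.sum_sub_distrib, ← Finset.mul_sum, hp, Finset.sum_neg_distrib]
      ring
    have h3 : ∑ j, -ψ j / t * q j = (-∑ j, ψ j * q j) / t := by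
      have e : ∀ j, -ψ j / t * q j = t⁻¹ * (-(ψ j * q j)) := by intro i; ring
      simp only [e, ← Finset.mul_sum, Finset.sum_neg_distrib]
      ring
    rw [h2, h3, ← add_div, div_le_iff₀ ht] at h1
    linarith

/-- Linear programming duality for finite optimal transport: if `D` bounds all values of the dual
problem, then some coupling of `p` and `q` costs at most `D`. A linear functional dominated by the
infimum of `dualValues` is positive, has marginals `p` and `q`, and is at most `D` at `d`. -/
theorem exists_finite_coupling [DecidableEq ι] (hp0 : ∀ i, 0 ≤ p i) (hq0 : ∀ i, 0 ≤ q i)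
    (hp : ∑ i, p i = 1) (hq : ∑ i, q i = 1)
    (hD : ∀ φ ψ : ι → ℝ, (∀ i j, φ i + ψ j ≤ d i j) →
      ∑ i, φ i * p i + ∑ j, ψ j * q j ≤ D) :
    ∃ ρ : ι → ι → ℝ, (∀ i j, 0 ≤ ρ i j) ∧ (∀ i, ∑ j, ρ i j = p i) ∧ (∀ j, ∑ i, ρ i j = q j) ∧
      ∑ i, ∑ j, ρ i j * d i j ≤ D := by
  set N : (ι × ι → ℝ) → ℝ := fun h => sInf (dualValues d p q D h) with hN
  have hbound : ∀ h : ι × ι → ℝ, ∃ b : ℝ, ∀ z, -b ≤ h z := fun h =>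
    ⟨∑ z, |h z|, fun z => by
      have := Finset.single_le_sum (f := fun z => |h z|) (fun _ _ => abs_nonneg _)
        (Finset.mem_univ z)
      have h2 := neg_abs_le (h z)
      linarith⟩
  have hbdd : ∀ h, BddBelow (dualValues d p q D h) := fun h => by
    obtain ⟨b, hb⟩ := hbound h
    exact ⟨-b, fun r hr => dualValues_lower_bound hp hD hp0 hq0 hq hb hr⟩
  have hne : ∀ h, (dualValues d p q D h).Nonempty := fun h =>
    ⟨_, fun _ => ∑ z, |h z|, 0, 0, le_rfl, fun i j => by
      have := Finset.single_le_sum (f := fun z => |h z|) (fun _ _ => abs_nonneg _)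
        (Finset.mem_univ (i, j))
      have h2 := le_abs_self (h (i, j))
      simp only [Pi.zero_apply, zero_mul, add_zero] at this ⊢
      linarith, rfl⟩
  have hle : ∀ (h : ι × ι → ℝ) (φ ψ : ι → ℝ) (t : ℝ), 0 ≤ t →
      (∀ i j, h (i, j) ≤ φ i + ψ j + t * d i j) →
      N h ≤ ∑ i, φ i * p i + ∑ j, ψ j * q j + t * D := fun h φ ψ t ht hdom =>
    csInf_le (hbdd h) ⟨φ, ψ, t, ht, hdom, rfl⟩
  have hsmul : ∀ c : ℝ, 0 < c → ∀ h, N (c • h) ≤ c * N h := by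
    intro c hc h
    rw [← div_le_iff₀' hc]
    refine le_csInf (hne h) ?_
    rintro r ⟨φ, ψ, t, ht, hdom, rfl⟩
    rw [div_le_iff₀' hc]
    refine (hle (c • h) (fun i => c * φ i) (fun j => c * ψ j) (c * t) (by positivity)
      (fun i j => ?_)).trans_eq ?_
    · have := mul_le_mul_of_nonneg_left (hdom i j) hc.le
      simp only [Pi.smul_apply, smul_eq_mul]
      linarith
    · simp only [mul_assoc, ← Finset.mul_sum]
      ring
  have N_hom : ∀ c : ℝ, 0 < c → ∀ h, N (c • h) = c * N h := by
    intro c hc h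
    refine le_antisymm (hsmul c hc h) ?_
    have := hsmul c⁻¹ (inv_pos.2 hc) (c • h)
    rw [smul_smul, inv_mul_cancel₀ hc.ne', one_smul, ← div_eq_inv_mul, le_div_iff₀' hc] at this
    exact this
  have N_add : ∀ h h', N (h + h') ≤ N h + N h' := by
    intro h h'
    rw [← sub_le_iff_le_add]
    refine le_csInf (hne h) ?_
    rintro r ⟨φ, ψ, t, ht, hdom, rfl⟩
    rw [sub_le_comm]
    refine le_csInf (hne h') ?_
    rintro r ⟨φ', ψ', t', ht', hdom', rfl⟩
    rw [sub_le_iff_le_add]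
    refine (hle (h + h') (φ + φ') (ψ + ψ') (t + t') (by positivity) (fun i j => ?_)).trans_eq ?_
    · have := hdom i j; have := hdom' i j
      simp only [Pi.add_apply]
      linarith
    · simp only [Pi.add_apply, add_mul, Finset.sum_add_distrib]
      ring
  obtain ⟨Λ, -, hΛ⟩ := exists_extension_of_le_sublinear (E := ι × ι → ℝ) ⊥ N N_hom N_add (by
    rintro ⟨x, hx⟩
    have hx0 : x = 0 := (Submodule.mem_bot ℝ).1 hx
    subst hx0
    have h0 : (⊥ : (ι × ι → ℝ) →ₗ.[ℝ] ℝ) ⟨0, hx⟩ = 0 := LinearPMap.map_zero _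
    rw [h0]
    refine le_csInf (hne 0) fun r hr => ?_
    simpa using dualValues_lower_bound hp hD hp0 hq0 hq (h := 0) (b := 0) (by simp) hr)
  have hpos : ∀ h : ι × ι → ℝ, (∀ z, 0 ≤ h z) → 0 ≤ Λ h := by
    intro h hh
    have h1 := (hΛ (-h)).trans (hle (-h) 0 0 0 le_rfl (fun i j => by simpa using hh (i, j)))
    simp only [map_neg, Pi.zero_apply, zero_mul, Finset.sum_const_zero, add_zero] at h1
    linarith
  have hmarg : ∀ φ ψ : ι → ℝ, Λ (fun z => φ z.1 + ψ z.2) = ∑ i, φ i * p i + ∑ j, ψ j * q j := by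
    intro φ ψ
    have h1 := (hΛ (fun z => φ z.1 + ψ z.2)).trans (hle _ φ ψ 0 le_rfl (fun i j => by simp))
    have h2 := (hΛ (-fun z => φ z.1 + ψ z.2)).trans
      (hle _ (-φ) (-ψ) 0 le_rfl (fun i j => by simp))
    simp only [map_neg, Pi.neg_apply, neg_mul, Finset.sum_neg_distrib, zero_mul, add_zero]
      at h1 h2
    linarith
  have hdecomp : ∀ h : ι × ι → ℝ, Λ h = ∑ i, ∑ j, Λ (Pi.single (i, j) 1) * h (i, j) := by
    intro h
    conv_lhs => rw [pi_eq_sum_univ' h, map_sum]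
    rw [Fintype.sum_prod_type]
    refine Finset.sum_congr rfl fun i _ => Finset.sum_congr rfl fun j _ => ?_
    rw [map_smul, smul_eq_mul, mul_comm]
  refine ⟨fun i j => Λ (Pi.single (i, j) 1), fun i j => hpos _ fun z => ?_, fun i => ?_,
    fun j => ?_, ?_⟩
  · by_cases hz : z = (i, j)
    · subst hz; simp
    · simp [hz]
  · have := hmarg (Pi.single i 1) 0
    rw [hdecomp] at this
    simpa [Pi.single_apply, Finset.sum_ite_eq'] using this
  · have := hmarg 0 (Pi.single j 1)
    rw [hdecomp] at this
    simpa [Pi.single_apply, Finset.sum_ite_eq'] using this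
  · have h1 := (hΛ (fun z => d z.1 z.2)).trans (hle _ 0 0 1 zero_le_one (fun i j => by simp))
    rw [hdecomp] at h1
    simpa using h1

end FiniteTransport

/-! ### The `ℓ¹` norm and first moments -/

section L1

variable {m : ℕ}

@[fun_prop]
theorem measurable_l1 : Measurable (l1 : Vec m → ℝ≥0∞) := by
  unfold l1; fun_prop

@[simp]
theorem l1_zero : l1 (0 : Vec m) = 0 := by simp [l1]

theorem l1_add_le (x y : Vec m) : l1 (x + y) ≤ l1 x + l1 y := by
  unfold l1
  rw [← Finset.sum_add_distrib]
  exact Finset.sum_le_sum fun i _ => enorm_add_le _ _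

@[simp]
theorem l1_neg (x : Vec m) : l1 (-x) = l1 x := by simp [l1]

theorem l1_sub_comm (x y : Vec m) : l1 (x - y) = l1 (y - x) := by
  rw [← l1_neg, neg_sub]

theorem l1_sub_le (x y z : Vec m) : l1 (x - z) ≤ l1 (x - y) + l1 (y - z) := by
  simpa using l1_add_le (x - y) (y - z)

theorem l1_smul (c : ℝ) (x : Vec m) : l1 (c • x) = ‖c‖ₑ * l1 x := by
  simp [l1, enorm_mul, Finset.mul_sum]

theorem l1_ne_top (x : Vec m) : l1 x ≠ ⊤ := by
  simp [l1, ENNReal.sum_eq_top]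

theorem l1_lt_top (x : Vec m) : l1 x < ⊤ := (l1_ne_top x).lt_top

theorem enorm_le_l1 (x : Vec m) : ‖x‖ₑ ≤ l1 x := by
  have h1 : l1 x = ENNReal.ofReal (∑ i, ‖x i‖) := by
    rw [ENNReal.ofReal_sum_of_nonneg (fun _ _ => norm_nonneg _)]
    exact Finset.sum_congr rfl fun i _ => (ofReal_norm (x i)).symm
  rw [h1, ← ofReal_norm]
  refine ENNReal.ofReal_le_ofReal ((pi_norm_le_iff_of_nonneg (by positivity)).2 fun i => ?_)
  exact Finset.single_le_sum (f := fun i => ‖x i‖) (fun _ _ => norm_nonneg _) (Finset.mem_univ i)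

theorem l1_le_enorm (x : Vec m) : l1 x ≤ m * ‖x‖ₑ := by
  refine (Finset.sum_le_card_nsmul _ _ ‖x‖ₑ fun i _ => ?_).trans_eq (by simp)
  rw [← ofReal_norm, ← ofReal_norm]
  exact ENNReal.ofReal_le_ofReal (norm_le_pi_norm x i)

/-- The first absolute moment of a measure on `ℝᵐ`, for the `ℓ¹` norm. -/
noncomputable def moment (ν : Measure (Vec m)) : ℝ≥0∞ := ∫⁻ g, l1 g ∂ν

@[simp]
theorem moment_dirac (x : Vec m) : moment (Measure.dirac x) = l1 x :=
  lintegral_dirac' _ measurable_l1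

theorem integrable_id_of_moment {ν : Measure (Vec m)} (h : moment ν < ⊤) :
    Integrable (fun g => g) ν :=
  ⟨measurable_id.aestronglyMeasurable, (lintegral_mono fun g => enorm_le_l1 g).trans_lt h⟩

/-- Functions that are 1-Lipschitz for the `ℓ¹` norm. -/
def IsL1Lip (f : Vec m → ℝ) : Prop := ∀ x y, f x - f y ≤ (l1 (x - y)).toReal

theorem IsL1Lip.abs_sub_le {f : Vec m → ℝ} (hf : IsL1Lip f) (x y : Vec m) :
    |f x - f y| ≤ (l1 (x - y)).toReal := by
  refine abs_sub_le_iff.2 ⟨hf x y, ?_⟩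
  rw [l1_sub_comm]; exact hf y x

theorem IsL1Lip.continuous {f : Vec m → ℝ} (hf : IsL1Lip f) : Continuous f := by
  refine (LipschitzWith.of_dist_le_mul (K := m) fun x y => ?_).continuous
  rw [Real.dist_eq, dist_eq_norm]
  refine (hf.abs_sub_le x y).trans ?_
  refine (ENNReal.toReal_mono (by finiteness) (l1_le_enorm (x - y))).trans_eq ?_
  simp

theorem IsL1Lip.integrable {f : Vec m → ℝ} (hf : IsL1Lip f) {ν : Measure (Vec m)}
    [IsProbabilityMeasure ν] (h : moment ν < ⊤) : Integrable f ν := by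
  have h1 : Integrable (fun g => f g - f 0) ν := by
    refine ⟨(hf.continuous.sub continuous_const).aestronglyMeasurable, ?_⟩
    refine (lintegral_mono fun g => ?_).trans_lt h
    rw [← ofReal_norm, Real.norm_eq_abs, ENNReal.ofReal_le_iff_le_toReal (l1_ne_top _)]
    simpa using hf.abs_sub_le g 0
  simpa [Pi.add_def] using h1.add (integrable_const (f 0))

end L1

/-! ### Basic properties of the Wasserstein distance -/

section Wass

variable {m : ℕ}

theorem wass_le_of_coupling {μ ν : Measure (Vec m)} (ρ : Measure (Vec m × Vec m))
    (h1 : ρ.map Prod.fst = μ) (h2 : ρ.map Prod.snd = ν) :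
    wass μ ν ≤ ∫⁻ z, l1 (z.1 - z.2) ∂ρ :=
  iInf_le_of_le ρ (iInf_le_of_le h1 (iInf_le_of_le h2 le_rfl))

theorem wass_lt_iff {μ ν : Measure (Vec m)} {a : ℝ≥0∞} : wass μ ν < a ↔
    ∃ ρ : Measure (Vec m × Vec m), ρ.map Prod.fst = μ ∧ ρ.map Prod.snd = ν ∧
      ∫⁻ z, l1 (z.1 - z.2) ∂ρ < a := by
  simp only [wass, iInf_lt_iff, exists_prop]

theorem wass_dirac_zero (ν : Measure (Vec m)) [IsProbabilityMeasure ν] :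
    wass ν (Measure.dirac 0) = moment ν := by
  refine le_antisymm ?_ ?_
  · refine (wass_le_of_coupling (ν.map fun g => (g, 0)) ?_ ?_).trans_eq ?_
    · rw [Measure.map_map measurable_fst (by fun_prop)]
      exact Measure.map_id
    · rw [Measure.map_map measurable_snd (by fun_prop)]
      simp [Function.comp_def, Measure.map_const]
    · rw [lintegral_map (by fun_prop) (by fun_prop)]
      simp [moment]
  · refine le_iInf fun ρ => le_iInf fun h1 => le_iInf fun h2 => ?_
    have h0 : ∀ᵐ z ∂ρ, z.2 = 0 := by
      have : ∀ᵐ g ∂(ρ.map Prod.snd), g = 0 := by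
        rw [h2]
        exact (ae_dirac_iff (measurableSet_singleton (0 : Vec m))).2 rfl
      exact ae_of_ae_map measurable_snd.aemeasurable this
    rw [moment, ← h1, lintegral_map measurable_l1 measurable_fst]
    refine (lintegral_congr_ae ?_).le
    filter_upwards [h0] with z hz
    simp [hz]

theorem inP1_iff {ν : Measure (Vec m)} : InP1 ν ↔ IsProbabilityMeasure ν ∧ moment ν < ⊤ := by
  unfold InP1
  constructor
  · rintro ⟨h, h'⟩
    rw [wass_dirac_zero] at h'
    exact ⟨h, h'⟩
  · rintro ⟨h, h'⟩
    rw [← wass_dirac_zero] at h'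
    exact ⟨h, h'⟩

theorem InP1.moment_lt_top {ν : Measure (Vec m)} (h : InP1 ν) : moment ν < ⊤ := (inP1_iff.1 h).2

theorem wass_le_swap (μ ν : Measure (Vec m)) : wass ν μ ≤ wass μ ν := by
  refine le_iInf fun ρ => le_iInf fun h1 => le_iInf fun h2 => ?_
  refine (wass_le_of_coupling (ρ.map Prod.swap) ?_ ?_).trans_eq ?_
  · rw [Measure.map_map measurable_fst measurable_swap]; exact h2
  · rw [Measure.map_map measurable_snd measurable_swap]; exact h1
  · rw [lintegral_map (by fun_prop) measurable_swap]
    exact lintegral_congr fun z => l1_sub_comm _ _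

theorem wass_comm (μ ν : Measure (Vec m)) : wass μ ν = wass ν μ :=
  le_antisymm (wass_le_swap _ _) (wass_le_swap _ _)

theorem isProbabilityMeasure_of_map_fst {α β : Type*} [MeasurableSpace α] [MeasurableSpace β]
    {μ : Measure α} [IsProbabilityMeasure μ] {ρ : Measure (α × β)} (h : ρ.map Prod.fst = μ) :
    IsProbabilityMeasure ρ := by
  subst h
  exact Measure.isProbabilityMeasure_of_map (f := Prod.fst)

/-- The triangle inequality: two couplings are glued along their common marginal by
disintegrating the second one. -/
theorem wass_triangle (μ₁ μ₂ μ₃ : Measure (Vec m)) [IsProbabilityMeasure μ₁]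
    [IsProbabilityMeasure μ₂] : wass μ₁ μ₃ ≤ wass μ₁ μ₂ + wass μ₂ μ₃ := by
  refine ENNReal.le_of_forall_pos_le_add fun ε hε hfin => ?_
  have hε' : (ε / 2 : ℝ≥0∞) ≠ 0 := by simpa using hε.ne'
  obtain ⟨ρ, hρ1, hρ2, hρ⟩ := wass_lt_iff.1
    (ENNReal.lt_add_right (ENNReal.add_lt_top.1 hfin).1.ne hε')
  obtain ⟨τ, hτ1, hτ2, hτ⟩ := wass_lt_iff.1
    (ENNReal.lt_add_right (ENNReal.add_lt_top.1 hfin).2.ne hε')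
  have : IsProbabilityMeasure ρ := isProbabilityMeasure_of_map_fst hρ1
  have : IsProbabilityMeasure τ := isProbabilityMeasure_of_map_fst hτ1
  set κ : Kernel (Vec m × Vec m) (Vec m) := τ.condKernel.comap Prod.snd measurable_snd with hκ
  set σ : Measure ((Vec m × Vec m) × Vec m) := ρ ⊗ₘ κ with hσ
  have hσ1 : σ.map Prod.fst = ρ := Measure.fst_compProd ρ κ
  have hσ2 : σ.map (fun z => (z.1.2, z.2)) = τ := by
    have hτ' : τ.fst = ρ.map Prod.snd := hτ1.trans hρ2.symm
    refine Measure.ext_of_lintegral _ fun f hf => ?_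
    rw [lintegral_map hf (by fun_prop), hσ, Measure.lintegral_compProd (by fun_prop)]
    conv_rhs => rw [← τ.disintegrate τ.condKernel, Measure.lintegral_compProd hf, hτ',
      lintegral_map (Measurable.lintegral_kernel_prod_right' hf) measurable_snd]
    rfl
  refine (wass_le_of_coupling (σ.map fun z => (z.1.1, z.2)) ?_ ?_).trans ?_
  · rw [Measure.map_map measurable_fst (by fun_prop), ← hρ1, ← hσ1,
      Measure.map_map measurable_fst measurable_fst]
    rfl
  · rw [Measure.map_map measurable_snd (by fun_prop), ← hτ2, ← hσ2,
      Measure.map_map measurable_snd (by fun_prop)]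
    rfl
  · rw [lintegral_map (by fun_prop) (by fun_prop)]
    calc ∫⁻ z, l1 (z.1.1 - z.2) ∂σ
        ≤ ∫⁻ z, (l1 (z.1.1 - z.1.2) + l1 (z.1.2 - z.2)) ∂σ :=
          lintegral_mono fun z => l1_sub_le _ _ _
      _ = ∫⁻ z, l1 (z.1 - z.2) ∂ρ + ∫⁻ z, l1 (z.1 - z.2) ∂τ := by
          rw [lintegral_add_left (by fun_prop)]
          conv_rhs => rw [← hσ1, ← hσ2, lintegral_map (by fun_prop) measurable_fst,
            lintegral_map (by fun_prop) (by fun_prop)]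
      _ ≤ (wass μ₁ μ₂ + ε / 2) + (wass μ₂ μ₃ + ε / 2) := add_le_add hρ.le hτ.le
      _ = wass μ₁ μ₂ + wass μ₂ μ₃ + ε := by
          rw [add_add_add_comm, ENNReal.add_halves]

theorem wass_map_map_le {Ω : Type*} [MeasurableSpace Ω] (P : Measure Ω) {f g : Ω → Vec m}
    (hf : Measurable f) (hg : Measurable g) :
    wass (P.map f) (P.map g) ≤ ∫⁻ z, l1 (f z - g z) ∂P := by
  refine (wass_le_of_coupling (P.map fun z => (f z, g z)) ?_ ?_).trans_eq ?_
  · rw [Measure.map_map measurable_fst (by fun_prop)]; rfl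
  · rw [Measure.map_map measurable_snd (by fun_prop)]; rfl
  · rw [lintegral_map (by fun_prop) (by fun_prop)]

/-- A map that contracts the `ℓ¹` norm by the factor `c` contracts the Wasserstein distance. -/
theorem wass_map_le {f : Vec m → Vec m} (hf : Measurable f) {c : ℝ≥0∞} (hc0 : c ≠ 0)
    (hc : c ≠ ⊤) (h : ∀ x y, l1 (f x - f y) ≤ c * l1 (x - y)) (μ ν : Measure (Vec m)) :
    wass (μ.map f) (ν.map f) ≤ c * wass μ ν := by
  conv_rhs => rw [wass]
  simp only [ENNReal.mul_iInf_of_ne hc0 hc]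
  refine le_iInf fun ρ => le_iInf fun h1 => le_iInf fun h2 => ?_
  rw [← h1, ← h2, Measure.map_map hf measurable_fst, Measure.map_map hf measurable_snd]
  refine (wass_map_map_le ρ (by fun_prop) (by fun_prop)).trans ?_
  rw [← lintegral_const_mul _ (by fun_prop)]
  exact lintegral_mono fun z => h _ _

theorem wass_map_add (c : Vec m) (μ ν : Measure (Vec m)) :
    wass (μ.map fun g => c + g) (ν.map fun g => c + g) ≤ wass μ ν := by
  simpa using wass_map_le (f := fun g : Vec m => c + g) (by fun_prop) one_ne_zero
    ENNReal.one_ne_top (fun x y => by simp) μ ν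

end Wass

/-! ### Kantorovich–Rubinstein duality -/

section Duality

variable {m : ℕ}

theorem IsL1Lip.ofReal_integral_sub_le_wass {f : Vec m → ℝ} (hf : IsL1Lip f)
    {μ ν : Measure (Vec m)} [IsProbabilityMeasure μ] [IsProbabilityMeasure ν]
    (hμ : moment μ < ⊤) (hν : moment ν < ⊤) :
    ENNReal.ofReal (∫ g, f g ∂μ - ∫ g, f g ∂ν) ≤ wass μ ν := by
  refine le_iInf fun ρ => le_iInf fun h1 => le_iInf fun h2 => ?_
  have i1 : Integrable (fun z => f z.1) ρ := by
    have := hf.integrable hμ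
    rw [← h1] at this
    exact this.comp_measurable measurable_fst
  have i2 : Integrable (fun z => f z.2) ρ := by
    have := hf.integrable hν
    rw [← h2] at this
    exact this.comp_measurable measurable_snd
  have e1 : ∫ g, f g ∂μ = ∫ z, f z.1 ∂ρ := by
    rw [← h1, integral_map measurable_fst.aemeasurable hf.continuous.aestronglyMeasurable]
  have e2 : ∫ g, f g ∂ν = ∫ z, f z.2 ∂ρ := by
    rw [← h2, integral_map measurable_snd.aemeasurable hf.continuous.aestronglyMeasurable]
  rw [e1, e2, ← integral_sub i1 i2]
  refine (Real.ofReal_le_enorm _).trans ((enorm_integral_le_lintegral_enorm _).trans ?_)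
  refine lintegral_mono fun z => ?_
  rw [← ofReal_norm, Real.norm_eq_abs, ENNReal.ofReal_le_iff_le_toReal (l1_ne_top _)]
  exact hf.abs_sub_le _ _

theorem map_simpleFunc_eq_sum (q : SimpleFunc (Vec m) (Vec m)) (μ : Measure (Vec m))
    [IsFiniteMeasure μ] :
    μ.map q = ∑ i : q.range, ENNReal.ofReal (μ.real (q ⁻¹' {i.1})) • Measure.dirac i.1 := by
  refine Measure.ext_of_lintegral _ fun f hf => ?_
  rw [lintegral_map hf q.measurable, lintegral_finsetSum_measure]
  simp only [lintegral_smul_measure, lintegral_dirac' _ hf, smul_eq_mul]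
  have h1 : ∫⁻ x, f (q x) ∂μ = (q.map f).lintegral μ := by
    rw [← SimpleFunc.lintegral_eq_lintegral]; rfl
  rw [h1, SimpleFunc.map_lintegral, ← Finset.sum_coe_sort]
  exact Finset.sum_congr rfl fun i _ => by rw [ofReal_measureReal, mul_comm]

theorem sum_real_preimage_simpleFunc (q : SimpleFunc (Vec m) (Vec m)) (μ : Measure (Vec m))
    [IsProbabilityMeasure μ] : ∑ i : q.range, μ.real (q ⁻¹' {i.1}) = 1 := by
  have h := congrArg (fun ν : Measure (Vec m) => ν univ) (map_simpleFunc_eq_sum q μ)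
  simp only [Measure.map_apply q.measurable MeasurableSet.univ, preimage_univ, measure_univ,
    Measure.coe_finsetSum, Finset.sum_apply, Measure.smul_apply, smul_eq_mul, mul_one] at h
  rw [← ENNReal.ofReal_sum_of_nonneg (fun _ _ => measureReal_nonneg)] at h
  have := congrArg ENNReal.toReal h
  rwa [ENNReal.toReal_one, ENNReal.toReal_ofReal
    (Finset.sum_nonneg fun _ _ => measureReal_nonneg), eq_comm] at this

theorem integral_comp_simpleFunc {f : Vec m → ℝ} (hf : Continuous f)
    (q : SimpleFunc (Vec m) (Vec m)) (μ : Measure (Vec m)) [IsFiniteMeasure μ] :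
    ∫ x, f (q x) ∂μ = ∑ i : q.range, f i.1 * μ.real (q ⁻¹' {i.1}) := by
  rw [← integral_map q.measurable.aemeasurable hf.aestronglyMeasurable, map_simpleFunc_eq_sum q μ,
    integral_finsetSum_measure (fun i _ => ?_)]
  · refine Finset.sum_congr rfl fun i _ => ?_
    rw [integral_smul_measure, integral_dirac, ENNReal.toReal_ofReal measureReal_nonneg,
      smul_eq_mul, mul_comm]
  · exact (integrable_dirac (by simp)).smul_measure ENNReal.ofReal_ne_top

/-- The hard direction of the duality for measures that have been quantised to finitely many
points. The `c`-transform of a dual pair is the 1-Lipschitz function `⨅ j, ‖x - j‖₁ - ψ j`. -/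
theorem wass_map_simpleFunc_le (q : SimpleFunc (Vec m) (Vec m)) (μ ν : Measure (Vec m))
    [IsProbabilityMeasure μ] [IsProbabilityMeasure ν] {D : ℝ}
    (hD : ∀ f : Vec m → ℝ, IsL1Lip f → ∫ x, f (q x) ∂μ - ∫ x, f (q x) ∂ν ≤ D) :
    wass (μ.map q) (ν.map q) ≤ ENNReal.ofReal D := by
  classical
  set p : q.range → ℝ := fun i => μ.real (q ⁻¹' {i.1}) with hp
  set p' : q.range → ℝ := fun i => ν.real (q ⁻¹' {i.1}) with hp'
  have hne : (Finset.univ : Finset q.range).Nonempty :=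
    ⟨⟨q 0, SimpleFunc.mem_range_self q 0⟩, Finset.mem_univ _⟩
  obtain ⟨ρ, hρ0, hρ1, hρ2, hρ⟩ := exists_finite_coupling
    (d := fun i j : q.range => (l1 (i.1 - j.1)).toReal) (p := p) (q := p') (D := D)
    (fun _ => measureReal_nonneg) (fun _ => measureReal_nonneg)
    (sum_real_preimage_simpleFunc q μ) (sum_real_preimage_simpleFunc q ν) (by
      intro φ ψ hφψ
      set f : Vec m → ℝ := fun x => Finset.univ.inf' hne
        (fun j : q.range => (l1 (x - j.1)).toReal - ψ j) with hf
      have hlip : IsL1Lip f := by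
        intro x y
        obtain ⟨j, -, hj⟩ := Finset.exists_mem_eq_inf' hne
          (fun j : q.range => (l1 (y - j.1)).toReal - ψ j)
        have h1 : f x ≤ (l1 (x - j.1)).toReal - ψ j := Finset.inf'_le _ (Finset.mem_univ j)
        have h2 : f y = (l1 (y - j.1)).toReal - ψ j := hj
        have h3 : (l1 (x - j.1)).toReal ≤ (l1 (x - y)).toReal + (l1 (y - j.1)).toReal := by
          rw [← ENNReal.toReal_add (l1_ne_top _) (l1_ne_top _)]
          exact ENNReal.toReal_mono (ENNReal.add_ne_top.2 ⟨l1_ne_top _, l1_ne_top _⟩)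
            (l1_sub_le _ _ _)
        linarith
      have hφ : ∀ i, φ i ≤ f i.1 := fun i => Finset.le_inf' _ _ fun j _ => by
        have := hφψ i j; linarith
      have hψ : ∀ j, ψ j ≤ -f j.1 := fun j => by
        have : f j.1 ≤ (l1 (j.1 - j.1)).toReal - ψ j := Finset.inf'_le _ (Finset.mem_univ j)
        simp only [sub_self, l1_zero, ENNReal.toReal_zero] at this
        linarith
      have h := hD f hlip
      rw [integral_comp_simpleFunc hlip.continuous, integral_comp_simpleFunc hlip.continuous] at h
      have h1 : ∑ i, φ i * p i ≤ ∑ i, f i.1 * p i := Finset.sum_le_sum fun i _ =>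
        mul_le_mul_of_nonneg_right (hφ i) measureReal_nonneg
      have h2 : ∑ i, ψ i * p' i ≤ ∑ i, -f i.1 * p' i := Finset.sum_le_sum fun i _ =>
        mul_le_mul_of_nonneg_right (hψ i) measureReal_nonneg
      simp only [neg_mul, Finset.sum_neg_distrib] at h2
      linarith)
  have hint : ∀ g : Vec m × Vec m → ℝ≥0∞, Measurable g →
      ∫⁻ z, g z ∂(∑ i : q.range, ∑ j : q.range, ENNReal.ofReal (ρ i j) •
        Measure.dirac (i.1, j.1)) =
      ∑ i : q.range, ∑ j : q.range, ENNReal.ofReal (ρ i j) * g (i.1, j.1) := by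
    intro g hg
    simp only [lintegral_finsetSum_measure, lintegral_smul_measure, lintegral_dirac' _ hg,
      smul_eq_mul]
  refine (wass_le_of_coupling (∑ i : q.range, ∑ j : q.range, ENNReal.ofReal (ρ i j) •
    Measure.dirac (i.1, j.1)) ?_ ?_).trans ?_
  · rw [map_simpleFunc_eq_sum]
    refine Measure.ext_of_lintegral _ fun g hg => ?_
    rw [lintegral_map hg measurable_fst, hint _ (by fun_prop)]
    simp only [lintegral_finsetSum_measure, lintegral_smul_measure, lintegral_dirac' _ hg,
      smul_eq_mul, ← Finset.sum_mul]
    refine Finset.sum_congr rfl fun i _ => ?_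
    rw [← ENNReal.ofReal_sum_of_nonneg (fun j _ => hρ0 i j), hρ1]
  · rw [map_simpleFunc_eq_sum]
    refine Measure.ext_of_lintegral _ fun g hg => ?_
    rw [lintegral_map hg measurable_snd, hint _ (by fun_prop), Finset.sum_comm]
    simp only [lintegral_finsetSum_measure, lintegral_smul_measure, lintegral_dirac' _ hg,
      smul_eq_mul, ← Finset.sum_mul]
    refine Finset.sum_congr rfl fun j _ => ?_
    rw [← ENNReal.ofReal_sum_of_nonneg (fun i _ => hρ0 i j), hρ2]
  · rw [hint _ (by fun_prop)]
    refine le_trans (le_of_eq ?_) (ENNReal.ofReal_le_ofReal hρ)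
    rw [ENNReal.ofReal_sum_of_nonneg (fun i _ => Finset.sum_nonneg fun j _ =>
      mul_nonneg (hρ0 i j) ENNReal.toReal_nonneg)]
    refine Finset.sum_congr rfl fun i _ => ?_
    rw [ENNReal.ofReal_sum_of_nonneg (fun j _ => mul_nonneg (hρ0 i j) ENNReal.toReal_nonneg)]
    refine Finset.sum_congr rfl fun j _ => ?_
    rw [ENNReal.ofReal_mul (hρ0 i j), ENNReal.ofReal_toReal (l1_ne_top _)]

theorem exists_simpleFunc_approx (μ : Measure (Vec m)) (hμ : moment μ < ⊤) {ε : ℝ≥0∞}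
    (hε : 0 < ε) : ∃ q : SimpleFunc (Vec m) (Vec m), ∫⁻ x, l1 (q x - x) ∂μ < ε := by
  have h := SimpleFunc.tendsto_approxOn_range_L1_enorm (f := fun x : Vec m => x) (μ := μ)
    measurable_id (integrable_id_of_moment hμ)
  have h2 := ENNReal.Tendsto.const_mul (a := (m : ℝ≥0∞)) h (Or.inr (by simp))
  rw [mul_zero] at h2
  obtain ⟨n, hn⟩ := (h2.eventually (gt_mem_nhds hε)).exists
  refine ⟨SimpleFunc.approxOn (fun x : Vec m => x) measurable_id (range (fun x => x) ∪ {0}) 0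
    (by simp) n, lt_of_le_of_lt ?_ hn⟩
  rw [← lintegral_const_mul' _ _ (by simp)]
  exact lintegral_mono fun x => l1_le_enorm _

/-- Kantorovich–Rubinstein duality: the Wasserstein distance is bounded by any bound on the
differences of integrals of 1-Lipschitz functions. -/
theorem wass_le_of_forall_isL1Lip {μ ν : Measure (Vec m)} [IsProbabilityMeasure μ]
    [IsProbabilityMeasure ν] (hμ : moment μ < ⊤) (hν : moment ν < ⊤) {D : ℝ} (hD0 : 0 ≤ D)
    (hD : ∀ f : Vec m → ℝ, IsL1Lip f → ∫ x, f x ∂μ - ∫ x, f x ∂ν ≤ D) :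
    wass μ ν ≤ ENNReal.ofReal D := by
  refine ENNReal.le_of_forall_pos_le_add fun ε hε _ => ?_
  have hε' : (0 : ℝ≥0∞) < ε / 4 := by simpa [pos_iff_ne_zero] using hε.ne'
  -- one quantisation `q` serves both measures, because it is chosen for their sum
  obtain ⟨q, hq⟩ := exists_simpleFunc_approx (μ + ν) (by
    rw [moment, lintegral_add_measure]; exact ENNReal.add_lt_top.2 ⟨hμ, hν⟩) hε'
  rw [lintegral_add_measure] at hq
  have hqμ : ∫⁻ x, l1 (q x - x) ∂μ ≤ ε / 4 := le_self_add.trans hq.le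
  have hqν : ∫⁻ x, l1 (q x - x) ∂ν ≤ ε / 4 := le_add_self.trans hq.le
  have hfin : ∀ (κ : Measure (Vec m)), ∫⁻ x, l1 (q x - x) ∂κ ≤ ε / 4 → ∀ f : Vec m → ℝ,
      IsL1Lip f → Integrable f κ → Integrable (fun x => f (q x)) κ →
      |∫ x, f (q x) ∂κ - ∫ x, f x ∂κ| ≤ ε / 4 := by
    intro κ hκ f hf hi hi'
    rw [← integral_sub hi' hi, ← Real.norm_eq_abs]
    have hε4 : ((ε : ℝ≥0∞) / 4).toReal = ε / 4 := by simp
    rw [← hε4]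
    refine (norm_integral_le_lintegral_norm _).trans (ENNReal.toReal_mono (by finiteness) ?_)
    refine (lintegral_mono fun x => ?_).trans hκ
    rw [ENNReal.ofReal_le_iff_le_toReal (l1_ne_top _)]
    exact hf.abs_sub_le _ _
  have hfinq : ∀ (κ : Measure (Vec m)) [IsProbabilityMeasure κ] (f : Vec m → ℝ), IsL1Lip f →
      Integrable (fun x => f (q x)) κ := by
    intro κ _ f hf
    have := (q.map f).integrable_of_isFiniteMeasure (μ := κ)
    exact this
  have h1 : wass (μ.map q) (ν.map q) ≤ ENNReal.ofReal (D + ε / 2) := by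
    refine wass_map_simpleFunc_le q μ ν fun f hf => ?_
    have a1 := abs_le.1 (hfin μ hqμ f hf (hf.integrable hμ) (hfinq μ f hf))
    have a2 := abs_le.1 (hfin ν hqν f hf (hf.integrable hν) (hfinq ν f hf))
    have := hD f hf
    linarith [a1.2, a2.1]
  have : IsProbabilityMeasure (μ.map q) :=
    Measure.isProbabilityMeasure_map q.measurable.aemeasurable
  have : IsProbabilityMeasure (ν.map q) :=
    Measure.isProbabilityMeasure_map q.measurable.aemeasurable
  have h2 : wass (μ.map q) μ ≤ ε / 4 := by
    have := wass_map_map_le μ q.measurable measurable_id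
    rw [Measure.map_id] at this
    exact this.trans hqμ
  have h3 : wass (ν.map q) ν ≤ ε / 4 := by
    have := wass_map_map_le ν q.measurable measurable_id
    rw [Measure.map_id] at this
    exact this.trans hqν
  calc wass μ ν ≤ wass μ (μ.map q) + wass (μ.map q) ν := wass_triangle _ _ _
    _ ≤ wass μ (μ.map q) + (wass (μ.map q) (ν.map q) + wass (ν.map q) ν) := by
        gcongr; exact wass_triangle _ _ _
    _ ≤ ε / 4 + (ENNReal.ofReal (D + ε / 2) + ε / 4) := by
        rw [wass_comm μ]; gcongr
    _ = ENNReal.ofReal D + ε := by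
        have : (ε : ℝ≥0∞) / 4 = ENNReal.ofReal (ε / 4) := by
          rw [ENNReal.ofReal_div_of_pos (by norm_num)]; simp
        rw [this, ← ENNReal.ofReal_add (by positivity) (by positivity),
          ← ENNReal.ofReal_add (by positivity) (by positivity), ← ENNReal.ofReal_coe_nnreal,
          ← ENNReal.ofReal_add hD0 (by positivity)]
        congr 1; ring

theorem integral_bind_kernel {Ω : Type*} [MeasurableSpace Ω] {P : Measure Ω}
    [SFinite P] {κ : Kernel Ω (Vec m)} [IsSFiniteKernel κ] {f : Vec m → ℝ}
    (hf : Integrable f (P.bind κ)) : ∫ g, f g ∂(P.bind κ) = ∫ x, ∫ g, f g ∂(κ x) ∂P := by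
  rw [Measure.comp_eq_comp_const_apply] at hf ⊢
  rw [Kernel.integral_comp hf, Kernel.const_apply]

theorem integrable_integral_bind_kernel {Ω : Type*} [MeasurableSpace Ω] {P : Measure Ω}
    [SFinite P] {κ : Kernel Ω (Vec m)} [IsSFiniteKernel κ] {f : Vec m → ℝ}
    (hf : Integrable f (P.bind κ)) : Integrable (fun x => ∫ g, f g ∂(κ x)) P := by
  rw [Measure.comp_eq_comp_const_apply] at hf
  simpa using hf.integral_comp

theorem measurable_moment {Ω : Type*} [MeasurableSpace Ω] (κ : Kernel Ω (Vec m)) :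
    Measurable fun x => moment (κ x) := measurable_l1.lintegral_kernel

theorem moment_bind {Ω : Type*} [MeasurableSpace Ω] (P : Measure Ω) (κ : Kernel Ω (Vec m)) :
    moment (P.bind κ) = ∫⁻ x, moment (κ x) ∂P :=
  Measure.lintegral_bind κ.aemeasurable measurable_l1.aemeasurable

/-- The Wasserstein distance is convex: mixing two families that are uniformly within `D` of each
other gives measures within `D` of each other. -/
theorem wass_bind_le {Ω : Type*} [MeasurableSpace Ω] (P : Measure Ω) [IsProbabilityMeasure P]
    (κ κ' : Kernel Ω (Vec m)) [IsMarkovKernel κ] [IsMarkovKernel κ']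
    (hκ : moment (P.bind κ) < ⊤) (hκ' : moment (P.bind κ') < ⊤) {D : ℝ≥0∞}
    (hD : ∀ x, wass (κ x) (κ' x) ≤ D) : wass (P.bind κ) (P.bind κ') ≤ D := by
  rcases eq_or_ne D ⊤ with rfl | hDtop
  · exact le_top
  have hm : ∀ {η : Kernel Ω (Vec m)}, moment (P.bind η) < ⊤ → ∀ᵐ x ∂P, moment (η x) < ⊤ := by
    intro η h
    rw [moment_bind] at h
    exact ae_lt_top (measurable_moment η) h.ne
  rw [← ENNReal.ofReal_toReal hDtop]
  refine wass_le_of_forall_isL1Lip hκ hκ' ENNReal.toReal_nonneg fun f hf => ?_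
  rw [integral_bind_kernel (hf.integrable hκ), integral_bind_kernel (hf.integrable hκ'),
    ← integral_sub (integrable_integral_bind_kernel (hf.integrable hκ)) (integrable_integral_bind_kernel (hf.integrable hκ'))]
  refine (integral_mono_ae (g := fun _ => D.toReal)
    ((integrable_integral_bind_kernel (hf.integrable hκ)).sub (integrable_integral_bind_kernel (hf.integrable hκ')))
    (integrable_const _) ?_).trans_eq (by simp)
  filter_upwards [hm hκ, hm hκ'] with x hx hx'
  exact (ENNReal.ofReal_le_iff_le_toReal hDtop).1
    ((hf.ofReal_integral_sub_le_wass hx hx').trans (hD x))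

end Duality

/-! ### Indifference to mixtures of unbounded families -/

section Mixtures

variable {S : Type*} [MeasurableSpace S] {m : ℕ} {K : P1 m → ℝ}

theorem ev_of_inP1 {ν : Measure (Vec m)} (h : InP1 ν) : ev K ν = K ⟨ν, h⟩ := dif_pos h

/-- A Markov kernel with uniformly bounded first moments as a return distribution function. -/
noncomputable def RetDist.ofKernel (κ : Kernel (S × Vec m) (Vec m)) [IsMarkovKernel κ] {B : ℝ≥0∞}
    (hB : B < ⊤) (h : ∀ x, moment (κ x) ≤ B) : RetDist S m where
  ker := κ
  markov := inferInstance
  bounded := lt_of_le_of_lt (iSup_le fun x => by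
    rw [zeroDist, wass_dirac_zero]; exact h x) hB

theorem IndifferentToMixtures.bind_le_of_bounded (hmix : IndifferentToMixtures S K)
    (κ κ' : Kernel (S × Vec m) (Vec m)) [IsMarkovKernel κ] [IsMarkovKernel κ'] {B : ℝ≥0∞}
    (hB : B < ⊤) (hκ : ∀ x, moment (κ x) ≤ B) (hκ' : ∀ x, moment (κ' x) ≤ B)
    (hle : ∀ x, ev K (κ' x) ≤ ev K (κ x)) (lam : Measure (S × Vec m)) [IsProbabilityMeasure lam] :
    ev K (lam.bind κ') ≤ ev K (lam.bind κ) :=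
  hmix (RetDist.ofKernel κ hB hκ) (RetDist.ofKernel κ' hB hκ') hle lam inferInstance

theorem bind_two_dirac {X : Type*} [MeasurableSpace X] (κ : Kernel X (Vec m)) (p q : ℝ≥0∞)
    (x y : X) : (p • Measure.dirac x + q • Measure.dirac y).bind κ = p • κ x + q • κ y := by
  ext s hs
  rw [Measure.bind_apply hs κ.aemeasurable, lintegral_add_measure, lintegral_smul_measure,
    lintegral_smul_measure, lintegral_dirac' _ (κ.measurable_coe hs),
    lintegral_dirac' _ (κ.measurable_coe hs)]
  rfl

/-- Indifference to mixtures of two distributions. The two components are indexed by the sign of a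
coordinate of the stock. -/
theorem IndifferentToMixtures.two_point (hmix : IndifferentToMixtures S K) (s : S) (i₀ : Fin m)
    {ν ν' β β' : Measure (Vec m)} (hν : InP1 ν) (hν' : InP1 ν') (hβ : InP1 β) (hβ' : InP1 β')
    (h1 : ev K ν' ≤ ev K ν) (h2 : ev K β' ≤ ev K β) {p q : ℝ≥0∞} (hpq : p + q = 1) :
    ev K (p • ν' + q • β') ≤ ev K (p • ν + q • β) := by
  classical
  have := hν.1; have := hν'.1; have := hβ.1; have := hβ'.1
  have hE : MeasurableSet {x : S × Vec m | 0 < x.2 i₀} :=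
    measurableSet_lt measurable_const (by fun_prop)
  set κ : Kernel (S × Vec m) (Vec m) := Kernel.piecewise hE (Kernel.const _ ν) (Kernel.const _ β)
    with hκ
  set κ' : Kernel (S × Vec m) (Vec m) :=
    Kernel.piecewise hE (Kernel.const _ ν') (Kernel.const _ β') with hκ'
  set lam : Measure (S × Vec m) :=
    p • Measure.dirac (s, fun _ => 1) + q • Measure.dirac (s, 0) with hlam
  have : IsProbabilityMeasure lam := ⟨by simp [hlam, hpq]⟩
  have h := hmix.bind_le_of_bounded κ κ'
    (B := (moment ν + moment β) + (moment ν' + moment β'))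
    (by simp [hν.moment_lt_top, hβ.moment_lt_top, hν'.moment_lt_top, hβ'.moment_lt_top])
    (fun x => by
      rw [hκ, Kernel.piecewise_apply]
      split_ifs
      · exact le_add_right (le_add_right le_rfl)
      · exact le_add_right (le_add_left le_rfl))
    (fun x => by
      rw [hκ', Kernel.piecewise_apply]
      split_ifs
      · exact le_add_left (le_add_right le_rfl)
      · exact le_add_left (le_add_left le_rfl))
    (fun x => by
      rw [hκ, hκ', Kernel.piecewise_apply, Kernel.piecewise_apply]
      split_ifs
      · exact h1
      · exact h2) lam
  rw [hlam, bind_two_dirac, bind_two_dirac] at h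
  simpa [hκ, hκ', Kernel.piecewise_apply] using h

/-- The kernel `x ↦ w x • κ x + (1 - w x) • β`. -/
noncomputable def dilute {X : Type*} [MeasurableSpace X] (w : X → ℝ≥0∞) (hw : Measurable w)
    (κ : Kernel X (Vec m)) (β : Measure (Vec m)) : Kernel X (Vec m) where
  toFun x := w x • κ x + (1 - w x) • β
  measurable' := by
    refine Measure.measurable_of_measurable_coe _ fun s hs => ?_
    simp only [Measure.coe_add, Measure.coe_smul, Pi.add_apply, Pi.smul_apply, smul_eq_mul]
    exact (hw.mul (κ.measurable_coe hs)).add ((measurable_const.sub hw).mul_const _)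

theorem dilute_apply {X : Type*} [MeasurableSpace X] (w : X → ℝ≥0∞) (hw : Measurable w)
    (κ : Kernel X (Vec m)) (β : Measure (Vec m)) (x : X) :
    dilute w hw κ β x = w x • κ x + (1 - w x) • β := rfl

theorem isMarkovKernel_dilute {X : Type*} [MeasurableSpace X] {w : X → ℝ≥0∞} (hw : Measurable w)
    (hw1 : ∀ x, w x ≤ 1) (κ : Kernel X (Vec m)) [IsMarkovKernel κ] (β : Measure (Vec m))
    [IsProbabilityMeasure β] : IsMarkovKernel (dilute w hw κ β) :=
  ⟨fun x => ⟨by simp [dilute_apply, hw1 x]⟩⟩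

theorem moment_add (μ ν : Measure (Vec m)) : moment (μ + ν) = moment μ + moment ν :=
  lintegral_add_measure _ _ _

theorem moment_smul (c : ℝ≥0∞) (μ : Measure (Vec m)) : moment (c • μ) = c * moment μ :=
  lintegral_smul_measure _ _

/-- Rebalancing a mixture: outside `E` each component `κ x` is diluted with the average `β` of the
components in `E`, and its weight is increased by the factor `n x` in compensation. The factor `t`
for the components in `E` restores the total mass. -/
theorem bind_rebalanced {X : Type*} [MeasurableSpace X] (lam : Measure X)
    [IsProbabilityMeasure lam] (κ : Kernel X (Vec m)) {n : X → ℝ≥0∞} (hn : Measurable n)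
    (hn1 : ∀ x, 1 ≤ n x) (hntop : ∀ x, n x ≠ ⊤) {E : Set X} [DecidablePred (· ∈ E)]
    (hE : MeasurableSet E) (hE0 : lam E ≠ 0) {t : ℝ≥0∞} (ht : t * lam E + ∫⁻ x in Eᶜ, n x ∂lam = 1) :
    (t • lam.restrict E + (lam.restrict Eᶜ).withDensity n).bind
      (Kernel.piecewise hE κ (dilute (fun x => (n x)⁻¹) hn.inv κ ((lam[|E]).bind κ))) =
    lam.bind κ := by
  set β := (lam[|E]).bind κ with hβ
  have hEtop : lam E ≠ ⊤ := measure_ne_top _ _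
  ext s hs
  set a := ∫⁻ x in E, κ x s ∂lam with ha
  set b := ∫⁻ x in Eᶜ, κ x s ∂lam with hb
  set J := ∫⁻ x in Eᶜ, (n x - 1) ∂lam with hJ
  have hβs : β s = (lam E)⁻¹ * a := by
    rw [hβ, Measure.bind_apply hs κ.aemeasurable, ProbabilityTheory.cond, lintegral_smul_measure]
    rfl
  have hJn : J + lam Eᶜ = ∫⁻ x in Eᶜ, n x ∂lam := by
    rw [hJ, ← setLIntegral_one, ← lintegral_add_right _ measurable_const]
    exact lintegral_congr fun x => tsub_add_cancel_of_le (hn1 x)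
  have hcoef : t + J * (lam E)⁻¹ = 1 := by
    have h1 : t * lam E + J = lam E := by
      rw [← hJn, ← add_assoc, ← measure_univ (μ := lam), ← measure_add_measure_compl hE] at ht
      exact (ENNReal.add_left_inj (measure_ne_top _ _)).1 ht
    calc t + J * (lam E)⁻¹ = (t * lam E + J) * (lam E)⁻¹ := by
          rw [add_mul, mul_assoc, ENNReal.mul_inv_cancel hE0 hEtop, mul_one]
      _ = 1 := by rw [h1, ENNReal.mul_inv_cancel hE0 hEtop]
  have hR : lam.bind κ s = a + b := by
    rw [Measure.bind_apply hs κ.aemeasurable, ha, hb, lintegral_add_compl _ hE]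
  have hpw := Kernel.measurable_coe
    (Kernel.piecewise hE κ (dilute (fun x => (n x)⁻¹) hn.inv κ β)) hs
  rw [hR, Measure.bind_apply hs (Kernel.aemeasurable _), lintegral_add_measure,
    lintegral_smul_measure, lintegral_withDensity_eq_lintegral_mul _ hn hpw]
  have e1 : ∫⁻ x in E, Kernel.piecewise hE κ (dilute (fun x => (n x)⁻¹) hn.inv κ β) x s ∂lam
      = a := setLIntegral_congr_fun hE fun x hx => by simp [Kernel.piecewise_apply, hx]
  have e2 : ∫⁻ x in Eᶜ, (n * fun x =>
      Kernel.piecewise hE κ (dilute (fun x => (n x)⁻¹) hn.inv κ β) x s) x ∂lam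
      = b + J * β s := by
    rw [hJ, ← lintegral_mul_const _
      (show Measurable fun x => n x - 1 from hn.sub measurable_const), hb,
      ← lintegral_add_left (κ.measurable_coe hs)]
    refine setLIntegral_congr_fun hE.compl fun x hx => ?_
    have hx' : x ∉ E := hx
    have hx0 : n x ≠ 0 := fun h => by simpa [h] using hn1 x
    simp only [Pi.mul_apply, Kernel.piecewise_apply, hx', if_false, dilute_apply,
      Measure.coe_add, Measure.coe_smul, Pi.add_apply, Pi.smul_apply, smul_eq_mul]
    rw [mul_add, ← mul_assoc, ENNReal.mul_inv_cancel hx0 (hntop x), one_mul, ← mul_assoc,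
      ENNReal.mul_sub (fun _ _ => hntop x), mul_one, ENNReal.mul_inv_cancel hx0 (hntop x)]
  rw [e1, e2, hβs, smul_eq_mul]
  calc t * a + (b + J * ((lam E)⁻¹ * a)) = (t + J * (lam E)⁻¹) * a + b := by ring
    _ = a + b := by rw [hcoef, one_mul]

theorem exists_setLIntegral_tail_le {X : Type*} [MeasurableSpace X] {lam : Measure X}
    {n : X → ℝ≥0∞} (hn : Measurable n) (hntop : ∀ x, n x ≠ ⊤) (hint : ∫⁻ x, n x ∂lam ≠ ⊤)
    {ε : ℝ≥0∞} (hε : 0 < ε) : ∃ B : ℕ, ∫⁻ x in {x | n x ≤ B}ᶜ, n x ∂lam < ε := by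
  have hE : ∀ B : ℕ, MeasurableSet {x | n x ≤ B} := fun B => measurableSet_le hn measurable_const
  have h := tendsto_lintegral_of_dominated_convergence (μ := lam)
    (F := fun B : ℕ => ({x | n x ≤ B}ᶜ).indicator n) (f := fun _ => 0) n
    (fun B => hn.indicator (hE B).compl)
    (fun B => Filter.Eventually.of_forall fun x => indicator_le_self _ _ _) hint
    (Filter.Eventually.of_forall fun x => by
      obtain ⟨k, hk⟩ := ENNReal.exists_nat_gt (hntop x)
      refine tendsto_const_nhds.congr' ?_
      filter_upwards [Filter.eventually_ge_atTop k] with B hB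
      have : n x ≤ B := hk.le.trans (by exact_mod_cast hB)
      simp [this])
  rw [lintegral_zero] at h
  obtain ⟨B, hB⟩ := (h.eventually (gt_mem_nhds hε)).exists
  refine ⟨B, ?_⟩
  rwa [lintegral_indicator (hE B).compl] at hB

theorem eq_of_subsingleton_vec (hm : m = 0) (μ ν : Measure (Vec m)) [IsProbabilityMeasure μ]
    [IsProbabilityMeasure ν] : μ = ν := by
  subst hm
  ext s hs
  rcases s.eq_empty_or_nonempty with rfl | h
  · simp
  · simp [Subsingleton.eq_univ_of_nonempty h]

/-- Indifference to mixtures extends from families of bounded moment to families whose moment is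
merely integrable. The components of large moment are diluted by the average of the others, which
gives a bounded family with the same mixture; see `bind_rebalanced`. -/
theorem IndifferentToMixtures.bind_le (hmix : IndifferentToMixtures S K)
    (κ κ' : Kernel (S × Vec m) (Vec m)) [IsMarkovKernel κ] [IsMarkovKernel κ']
    (lam : Measure (S × Vec m)) [IsProbabilityMeasure lam]
    (hκ : ∀ x, moment (κ x) < ⊤) (hκ' : ∀ x, moment (κ' x) < ⊤)
    (hint : ∫⁻ x, moment (κ x) ∂lam < ⊤) (hint' : ∫⁻ x, moment (κ' x) ∂lam < ⊤)
    (hle : ∀ x, ev K (κ' x) ≤ ev K (κ x)) :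
    ev K (lam.bind κ') ≤ ev K (lam.bind κ) := by
  classical
  rcases Nat.eq_zero_or_pos m with hm | hm
  · rw [eq_of_subsingleton_vec hm (lam.bind κ') (lam.bind κ)]
  set n : S × Vec m → ℝ≥0∞ := fun x => 1 + (moment (κ x) + moment (κ' x)) with hn_def
  have hn : Measurable n :=
    measurable_const.add ((measurable_moment κ).add (measurable_moment κ'))
  have hn1 : ∀ x, 1 ≤ n x := fun x => le_self_add
  have hntop : ∀ x, n x ≠ ⊤ := fun x => by simp [hn_def, (hκ x).ne, (hκ' x).ne]
  have hnint : ∫⁻ x, n x ∂lam ≠ ⊤ := by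
    rw [hn_def, lintegral_add_left measurable_const, lintegral_add_left (measurable_moment κ)]
    simp [hint.ne, hint'.ne]
  obtain ⟨B, hB⟩ := exists_setLIntegral_tail_le hn hntop hnint zero_lt_one
  set E : Set (S × Vec m) := {x | n x ≤ B} with hE_def
  have hE : MeasurableSet E := measurableSet_le hn measurable_const
  have hEc : lam Eᶜ ≤ ∫⁻ x in Eᶜ, n x ∂lam := by
    rw [← setLIntegral_one]; exact lintegral_mono fun x => hn1 x
  have hE0 : lam E ≠ 0 := by
    intro h0
    have := measure_add_measure_compl (μ := lam) hE
    rw [h0, zero_add, measure_univ] at this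
    exact absurd (this ▸ hEc.trans_lt hB) (lt_irrefl _)
  have hEtop : lam E ≠ ⊤ := measure_ne_top _ _
  have hcond : IsProbabilityMeasure (lam[|E]) := cond_isProbabilityMeasure hE0
  set t : ℝ≥0∞ := (1 - ∫⁻ x in Eᶜ, n x ∂lam) * (lam E)⁻¹ with ht_def
  have ht : t * lam E + ∫⁻ x in Eᶜ, n x ∂lam = 1 := by
    rw [ht_def, mul_assoc, ENNReal.inv_mul_cancel hE0 hEtop, mul_one,
      tsub_add_cancel_of_le hB.le]
  have hκE : ∀ x ∈ E, moment (κ x) ≤ B := fun x hx =>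
    (le_add_left (le_add_right le_rfl)).trans hx
  have hκE' : ∀ x ∈ E, moment (κ' x) ≤ B := fun x hx =>
    (le_add_left (le_add_left le_rfl)).trans hx
  set β := (lam[|E]).bind κ with hβ
  set β' := (lam[|E]).bind κ' with hβ'
  have hmem : ∀ᵐ x ∂(lam[|E]), x ∈ E := ae_cond_mem hE
  have hβm : moment β ≤ B := by
    rw [hβ, moment_bind]
    exact (lintegral_mono_ae (hmem.mono hκE)).trans_eq (by simp)
  have hβm' : moment β' ≤ B := by
    rw [hβ', moment_bind]
    exact (lintegral_mono_ae (hmem.mono hκE')).trans_eq (by simp)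
  have hBtop : (B : ℝ≥0∞) < ⊤ := ENNReal.natCast_lt_top B
  have hβP : InP1 β := inP1_iff.2 ⟨inferInstance, hβm.trans_lt hBtop⟩
  have hβP' : InP1 β' := inP1_iff.2 ⟨inferInstance, hβm'.trans_lt hBtop⟩
  -- the bounded parts are compared by truncating the families to `δ₀` outside `E`
  have hββ : ev K β' ≤ ev K β := by
    have h := hmix.bind_le_of_bounded
      (Kernel.piecewise hE κ (Kernel.const _ (Measure.dirac 0)))
      (Kernel.piecewise hE κ' (Kernel.const _ (Measure.dirac 0))) hBtop
      (fun x => by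
        rw [Kernel.piecewise_apply]
        split_ifs with hx
        · exact hκE x hx
        · simp)
      (fun x => by
        rw [Kernel.piecewise_apply]
        split_ifs with hx
        · exact hκE' x hx
        · simp)
      (fun x => by
        rw [Kernel.piecewise_apply, Kernel.piecewise_apply]
        split_ifs with hx
        · exact hle x
        · exact le_rfl) (lam[|E])
    have hcongr : ∀ η : Kernel (S × Vec m) (Vec m),
        (lam[|E]).bind (Kernel.piecewise hE η (Kernel.const _ (Measure.dirac 0))) =
          (lam[|E]).bind η := fun η => by
      refine Measure.bind_congr_right ?_
      filter_upwards [hmem] with x hx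
      simp [Kernel.piecewise_apply, hx]
    rwa [hcongr, hcongr] at h
  have hw1 : ∀ x, (n x)⁻¹ ≤ 1 := fun x => ENNReal.inv_le_one.2 (hn1 x)
  have hMk := isMarkovKernel_dilute hn.inv hw1 κ β
  have hMk' := isMarkovKernel_dilute hn.inv hw1 κ' β'
  have hdil : ∀ (η : Kernel (S × Vec m) (Vec m)) (β₀ : Measure (Vec m)),
      (∀ x, moment (η x) ≤ n x) → moment β₀ ≤ B → ∀ x,
      moment (dilute (fun x => (n x)⁻¹) hn.inv η β₀ x) ≤ 1 + B := by
    intro η β₀ h h0 x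
    rw [dilute_apply, moment_add, moment_smul, moment_smul]
    refine add_le_add ?_ ((mul_le_of_le_one_left' tsub_le_self).trans h0)
    rw [mul_comm]
    exact ENNReal.div_le_of_le_mul (by simpa using h x)
  have hP : IsProbabilityMeasure (t • lam.restrict E + (lam.restrict Eᶜ).withDensity n) :=
    ⟨by simpa [withDensity_apply] using ht⟩
  have h := hmix.bind_le_of_bounded
    (Kernel.piecewise hE κ (dilute (fun x => (n x)⁻¹) hn.inv κ β))
    (Kernel.piecewise hE κ' (dilute (fun x => (n x)⁻¹) hn.inv κ' β'))
    (B := 1 + B) (by simp)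
    (fun x => by
      rw [Kernel.piecewise_apply]
      split_ifs with hx
      · exact (hκE x hx).trans le_add_self
      · exact hdil κ β (fun x => le_add_left (le_add_right le_rfl)) hβm x)
    (fun x => by
      rw [Kernel.piecewise_apply]
      split_ifs with hx
      · exact (hκE' x hx).trans le_add_self
      · exact hdil κ' β' (fun x => le_add_left (le_add_left le_rfl)) hβm' x)
    (fun x => by
      rw [Kernel.piecewise_apply, Kernel.piecewise_apply]
      split_ifs with hx
      · exact hle x
      · exact hmix.two_point x.1 ⟨0, hm⟩ (inP1_iff.2 ⟨inferInstance, hκ x⟩)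
          (inP1_iff.2 ⟨inferInstance, hκ' x⟩) hβP hβP' (hle x) hββ
          (add_tsub_cancel_of_le (hw1 x)))
    (t • lam.restrict E + (lam.restrict Eᶜ).withDensity n)
  rwa [bind_rebalanced lam κ hn hn1 hntop hE hE0 ht,
    bind_rebalanced lam κ' hn hn1 hntop hE hE0 ht] at h

/-- It suffices to compare almost every pair of components. -/
theorem IndifferentToMixtures.bind_le_of_ae (hmix : IndifferentToMixtures S K)
    (κ κ' : Kernel (S × Vec m) (Vec m)) [IsMarkovKernel κ] [IsMarkovKernel κ']
    (lam : Measure (S × Vec m)) [IsProbabilityMeasure lam]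
    (hκ : ∀ x, moment (κ x) < ⊤) (hκ' : ∀ x, moment (κ' x) < ⊤)
    (hint : ∫⁻ x, moment (κ x) ∂lam < ⊤) (hint' : ∫⁻ x, moment (κ' x) ∂lam < ⊤)
    (hle : ∀ᵐ x ∂lam, ev K (κ' x) ≤ ev K (κ x)) :
    ev K (lam.bind κ') ≤ ev K (lam.bind κ) := by
  classical
  obtain ⟨E, hEs, hE, hE0⟩ := exists_measurable_superset_of_null (ae_iff.1 hle)
  have hae : ∀ᵐ x ∂lam, Kernel.piecewise hE κ κ' x = κ' x := by
    filter_upwards [measure_eq_zero_iff_ae_notMem.1 hE0] with x hx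
    simp [Kernel.piecewise_apply, hx]
  rw [← Measure.bind_congr_right hae]
  refine hmix.bind_le κ (Kernel.piecewise hE κ κ') lam hκ (fun x => ?_) hint ?_ fun x => ?_
  · rw [Kernel.piecewise_apply]
    split_ifs
    exacts [hκ x, hκ' x]
  · rwa [lintegral_congr_ae (hae.mono fun x hx => by rw [hx])]
  · rw [Kernel.piecewise_apply]
    split_ifs with hx
    · exact le_rfl
    · by_contra h
      exact hx (hEs h)

end Mixtures

/-! ### Transitions between augmented states -/

section OneStep

variable {S A : Type*} [MeasurableSpace S] [MeasurableSpace A] {m : ℕ}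

/-- The family of laws of `c + G(s, c)`, with `G(s, c) ∼ ζ (s, c)`. -/
noncomputable def shift (ζ : Kernel (S × Vec m) (Vec m)) : Kernel (S × Vec m) (Vec m) :=
  (Kernel.id ×ₖ ζ).map (fun p => p.1.2 + p.2)

theorem lintegral_shift (ζ : Kernel (S × Vec m) (Vec m)) [IsMarkovKernel ζ] (x : S × Vec m)
    {f : Vec m → ℝ≥0∞} (hf : Measurable f) :
    ∫⁻ g, f g ∂(shift ζ x) = ∫⁻ g, f (x.2 + g) ∂(ζ x) := by
  rw [shift, Kernel.lintegral_map _ (by fun_prop) _ hf, Kernel.lintegral_id_prod (by fun_prop)]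

theorem shift_apply (ζ : Kernel (S × Vec m) (Vec m)) [IsMarkovKernel ζ] (x : S × Vec m) :
    shift ζ x = (ζ x).map (fun g => x.2 + g) :=
  Measure.ext_of_lintegral _ fun f hf => by
    rw [lintegral_shift ζ x hf, lintegral_map hf (by fun_prop)]

instance (ζ : Kernel (S × Vec m) (Vec m)) [IsMarkovKernel ζ] : IsMarkovKernel (shift ζ) :=
  Kernel.IsMarkovKernel.map _ (by fun_prop)

theorem objective_eq (K : P1 m → ℝ) (ζ : Kernel (S × Vec m) (Vec m)) [IsMarkovKernel ζ]
    (x : S × Vec m) : objective K ζ x = ev K (shift ζ x) := by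
  rw [objective, shift_apply]

theorem moment_map_add_le (c : Vec m) (ν : Measure (Vec m)) [IsProbabilityMeasure ν] :
    moment (ν.map fun g => c + g) ≤ l1 c + moment ν := by
  rw [moment, lintegral_map measurable_l1 (by fun_prop)]
  refine (lintegral_mono fun g => l1_add_le c g).trans_eq ?_
  rw [lintegral_add_left measurable_const]
  simp [moment]

theorem moment_map_smul (c : ℝ) (ν : Measure (Vec m)) :
    moment (ν.map fun g => c • g) = ‖c‖ₑ * moment ν := by
  rw [moment, lintegral_map measurable_l1 (by fun_prop)]
  simp_rw [l1_smul]
  rw [lintegral_const_mul _ measurable_l1, moment]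

theorem InP1.map_add {ν : Measure (Vec m)} (h : InP1 ν) (c : Vec m) :
    InP1 (ν.map fun g => c + g) := by
  have := h.1
  exact inP1_iff.2 ⟨Measure.isProbabilityMeasure_map (by fun_prop),
    (moment_map_add_le c ν).trans_lt (ENNReal.add_lt_top.2 ⟨l1_lt_top c, h.moment_lt_top⟩)⟩

theorem InP1.map_smul {ν : Measure (Vec m)} (h : InP1 ν) (c : ℝ) :
    InP1 (ν.map fun g => c • g) := by
  have := h.1
  refine inP1_iff.2 ⟨Measure.isProbabilityMeasure_map (by fun_prop), ?_⟩
  rw [moment_map_smul]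
  exact ENNReal.mul_lt_top (by simp) h.moment_lt_top

/-- A bound for the first moments of a return distribution function. -/
noncomputable def RetDist.bound (ζ : RetDist S m) : ℝ≥0∞ := wassSup ζ.ker (zeroDist (S × Vec m) m)

theorem RetDist.bound_lt_top (ζ : RetDist S m) : ζ.bound < ⊤ := ζ.bounded

theorem RetDist.moment_le (ζ : RetDist S m) (x : S × Vec m) : moment (ζ.ker x) ≤ ζ.bound := by
  rw [← wass_dirac_zero]
  exact le_iSup (fun x => wass (ζ.ker x) (zeroDist (S × Vec m) m x)) x

theorem RetDist.inP1 (ζ : RetDist S m) (x : S × Vec m) : InP1 (ζ.ker x) :=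
  inP1_iff.2 ⟨inferInstance, (ζ.moment_le x).trans_lt ζ.bound_lt_top⟩

theorem RetDist.moment_shift_le (ζ : RetDist S m) (x : S × Vec m) :
    moment (shift ζ.ker x) ≤ l1 x.2 + ζ.bound := by
  rw [shift_apply]
  exact (moment_map_add_le _ _).trans (add_le_add_right (ζ.moment_le x) _)

/-- The law of `C + G(S, C)`, with `(S, C) ∼ μ` and `G(s, c) ∼ ζ (s, c)`. -/
noncomputable def RetDist.mixture (ζ : RetDist S m) (μ : Measure (S × Vec m)) : Measure (Vec m) :=
  μ.bind (shift ζ.ker)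

theorem RetDist.lintegral_moment_shift_lt_top (ζ : RetDist S m) (μ : Measure (S × Vec m))
    [IsProbabilityMeasure μ] (hμ : ∫⁻ x, l1 x.2 ∂μ < ⊤) :
    ∫⁻ x, moment (shift ζ.ker x) ∂μ < ⊤ := by
  refine (lintegral_mono ζ.moment_shift_le).trans_lt ?_
  rw [lintegral_add_right _ measurable_const]
  simp [hμ, ζ.bound_lt_top]

theorem RetDist.inP1_mixture (ζ : RetDist S m) (μ : Measure (S × Vec m))
    [IsProbabilityMeasure μ] (hμ : ∫⁻ x, l1 x.2 ∂μ < ⊤) : InP1 (ζ.mixture μ) := by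
  refine inP1_iff.2 ⟨?_, ?_⟩
  · unfold RetDist.mixture; infer_instance
  · rw [RetDist.mixture, moment_bind]
    exact ζ.lintegral_moment_shift_lt_top μ hμ

theorem RetDist.mixture_dirac (ζ : RetDist S m) (x : S × Vec m) :
    ζ.mixture (Measure.dirac x) = shift ζ.ker x :=
  Measure.dirac_bind (Kernel.measurable _) x

/-- The objective of mixtures is monotone in the objectives of the components. -/
theorem IndifferentToMixtures.mixture_le {K : P1 m → ℝ} (hmix : IndifferentToMixtures S K)
    (ζ ζ' : RetDist S m) (μ : Measure (S × Vec m)) [IsProbabilityMeasure μ]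
    (hμ : ∫⁻ x, l1 x.2 ∂μ < ⊤) (hle : ∀ᵐ x ∂μ, objective K ζ'.ker x ≤ objective K ζ.ker x) :
    ev K (ζ'.mixture μ) ≤ ev K (ζ.mixture μ) := by
  have hfin : ∀ (ζ : RetDist S m) (x : S × Vec m), moment (shift ζ.ker x) < ⊤ := fun ζ x =>
    (ζ.moment_shift_le x).trans_lt (ENNReal.add_lt_top.2 ⟨l1_lt_top _, ζ.bound_lt_top⟩)
  refine hmix.bind_le_of_ae _ _ μ (hfin ζ) (hfin ζ')
    (ζ.lintegral_moment_shift_lt_top μ hμ) (ζ'.lintegral_moment_shift_lt_top μ hμ) ?_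
  filter_upwards [hle] with x hx
  rwa [objective_eq, objective_eq] at hx

theorem IndifferentToDiscount.ev_map_le {γ : ℝ} {K : P1 m → ℝ} (h : IndifferentToDiscount γ K)
    {ν ν' : Measure (Vec m)} (hν : InP1 ν) (hν' : InP1 ν') (hle : ev K ν' ≤ ev K ν) :
    ev K (ν'.map fun g => γ • g) ≤ ev K (ν.map fun g => γ • g) := by
  rw [ev_of_inP1 hν, ev_of_inP1 hν'] at hle
  exact h ⟨ν, hν⟩ ⟨ν', hν'⟩ hle

namespace MDP

variable (M : MDP S A m)

/-- The bound for the first moments of the rewards. -/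
noncomputable def rewardBound : ℝ≥0∞ := ⨆ z, ∫⁻ y, l1 y.1 ∂(M.P z)

theorem rewardBound_lt_top : M.rewardBound < ⊤ := M.reward_bounded

theorem lintegral_reward_le (z : (S × Vec m) × A) : ∫⁻ y, l1 y.1 ∂(M.P z) ≤ M.rewardBound :=
  le_iSup (fun z => ∫⁻ y, l1 y.1 ∂(M.P z)) z

theorem lintegral_aug (x : S × Vec m) (a : A) {f : Vec m × (S × Vec m) → ℝ≥0∞}
    (hf : Measurable f) :
    ∫⁻ y, f y ∂(M.aug (x, a)) = ∫⁻ y, f (y.1, (y.2, M.γ⁻¹ • (x.2 + y.1))) ∂(M.P (x, a)) := by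
  rw [aug, Kernel.lintegral_map _ M.measurable_aug _ hf]
  exact Kernel.lintegral_id_prod (f := fun p : ((S × Vec m) × A) × (Vec m × S) =>
    f (p.2.1, (p.2.2, M.γ⁻¹ • (p.1.1.2 + p.2.1)))) (by fun_prop) M.P (x, a)

/-- The transition kernel of the augmented states `(S_t, C_t)` under a stationary policy. -/
noncomputable def step (π : StatPolicy S A m) : Kernel (S × Vec m) (S × Vec m) :=
  (π.act ⊗ₖ M.aug).map (fun z => z.2.2)

instance (π : StatPolicy S A m) : IsMarkovKernel (M.step π) :=
  Kernel.IsMarkovKernel.map _ (by fun_prop)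

theorem lintegral_step (π : StatPolicy S A m) (x : S × Vec m) {f : S × Vec m → ℝ≥0∞}
    (hf : Measurable f) : ∫⁻ y, f y ∂(M.step π x) =
      ∫⁻ a, ∫⁻ y, f (y.2, M.γ⁻¹ • (x.2 + y.1)) ∂(M.P (x, a)) ∂(π.act x) := by
  rw [step, Kernel.lintegral_map _ (by fun_prop) _ hf,
    Kernel.lintegral_compProd _ _ _ (by fun_prop)]
  exact lintegral_congr fun a => M.lintegral_aug x a (f := fun y => f y.2) (by fun_prop)

theorem lintegral_stock_step_le (π : StatPolicy S A m) (x : S × Vec m) :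
    ∫⁻ y, l1 y.2 ∂(M.step π x) ≤ ‖M.γ⁻¹‖ₑ * (l1 x.2 + M.rewardBound) := by
  rw [M.lintegral_step π x (by fun_prop)]
  have h : ∀ a, ∫⁻ y, l1 (M.γ⁻¹ • (x.2 + y.1)) ∂(M.P (x, a)) ≤
      ‖M.γ⁻¹‖ₑ * (l1 x.2 + M.rewardBound) := fun a => by
    simp_rw [l1_smul]
    rw [lintegral_const_mul _ (by fun_prop)]
    gcongr
    refine (lintegral_mono fun y => l1_add_le _ _).trans ?_
    rw [lintegral_add_left measurable_const, lintegral_const, measure_univ, mul_one]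
    gcongr
    exact M.lintegral_reward_le _
  exact (lintegral_mono h).trans_eq (by simp)

/-! ### The distributional Bellman operator -/

open Classical in
theorem bellman_apply (π : StatPolicy S A m) (ζ : RetDist S m) (x : S × Vec m) :
    M.bellman π ζ x = if M.IsTerminal x.1 then Measure.dirac 0 else
      (((π.act ⊗ₖ M.aug) ⊗ₖ
        ζ.ker.comap (fun p : (S × Vec m) × Step S A m => p.2.2.2) (by fun_prop)).map
        (fun q => q.1.2.1 + M.γ • q.2)) x := rfl

theorem bellman_of_isTerminal (π : StatPolicy S A m) (ζ : RetDist S m) {x : S × Vec m}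
    (hx : M.IsTerminal x.1) : M.bellman π ζ x = Measure.dirac 0 := by
  rw [bellman_apply, if_pos hx]

theorem lintegral_bellman (π : StatPolicy S A m) (ζ : RetDist S m) {x : S × Vec m}
    (hx : ¬ M.IsTerminal x.1) {f : Vec m → ℝ≥0∞} (hf : Measurable f) :
    ∫⁻ g, f g ∂(M.bellman π ζ x) = ∫⁻ a, ∫⁻ y, ∫⁻ g, f (y.1 + M.γ • g)
      ∂(ζ.ker (y.2, M.γ⁻¹ • (x.2 + y.1))) ∂(M.P (x, a)) ∂(π.act x) := by
  rw [bellman_apply, if_neg hx, Kernel.lintegral_map _ (by fun_prop) _ hf,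
    Kernel.lintegral_compProd _ _ _ (by fun_prop)]
  have hmeas : Measurable fun y : Vec m × (S × Vec m) =>
      ∫⁻ g, f (y.1 + M.γ • g) ∂(ζ.ker y.2) := by
    have : Measurable fun p : (Vec m × (S × Vec m)) × Vec m => f (p.1.1 + M.γ • p.2) := by
      fun_prop
    exact this.lintegral_kernel_prod_right' (κ := ζ.ker.comap Prod.snd measurable_snd)
  simp only [Kernel.comap_apply]
  refine (Kernel.lintegral_compProd _ _ _ (hmeas.comp measurable_snd)).trans ?_
  exact lintegral_congr fun a => M.lintegral_aug x a
    (f := fun y => ∫⁻ g, f (y.1 + M.γ • g) ∂(ζ.ker y.2)) hmeas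

instance (π : StatPolicy S A m) (ζ : RetDist S m) : IsMarkovKernel (M.bellman π ζ) := by
  have : IsMarkovKernel (((π.act ⊗ₖ M.aug) ⊗ₖ
      ζ.ker.comap (fun p : (S × Vec m) × Step S A m => p.2.2.2) (by fun_prop)).map
      (fun q => q.1.2.1 + M.γ • q.2)) := Kernel.IsMarkovKernel.map _ (by fun_prop)
  refine ⟨fun x => ?_⟩
  rw [bellman_apply]
  split_ifs <;> infer_instance

/-- Families equal to `δ₀` at terminal states. -/
def ZeroAtTerminal (ζ : RetDist S m) : Prop :=
  ∀ (s : S) (c : Vec m), M.IsTerminal s → ζ.ker (s, c) = Measure.dirac 0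

theorem step_of_isTerminal (π : StatPolicy S A m) {x : S × Vec m} (hx : M.IsTerminal x.1) :
    M.step π x = Measure.dirac (x.1, M.γ⁻¹ • x.2) := by
  refine Measure.ext_of_lintegral _ fun f hf => ?_
  rw [M.lintegral_step π x hf, lintegral_dirac' _ hf]
  have h : ∀ a, M.P (x, a) = Measure.dirac (0, x.1) := fun a => hx x.2 a
  have h2 : Measurable fun y : Vec m × S => f (y.2, M.γ⁻¹ • (x.2 + y.1)) := by fun_prop
  simp_rw [h, lintegral_dirac' _ h2]
  simp

/-- The stock absorbs the reward: `c + R' + γ G(S', C') = γ (C' + G(S', C'))`. Hence applying the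
Bellman operator at `(s, c)` amounts to taking the mixture over the next augmented state. -/
theorem shift_bellman (π : StatPolicy S A m) (ζ : RetDist S m) {x : S × Vec m}
    (hx : ¬ M.IsTerminal x.1 ∨ M.ZeroAtTerminal ζ) :
    shift (M.bellman π ζ) x = (ζ.mixture (M.step π x)).map (fun g => M.γ • g) := by
  by_cases hT : M.IsTerminal x.1
  · have h0 : M.ZeroAtTerminal ζ := hx.resolve_left (not_not.2 hT)
    rw [shift_apply, M.bellman_of_isTerminal π ζ hT, M.step_of_isTerminal π hT,
      RetDist.mixture_dirac, shift_apply, h0 _ _ hT,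
      Measure.map_map (by fun_prop) (by fun_prop), Measure.map_dirac' (by fun_prop),
      Measure.map_dirac' (by fun_prop)]
    simp [M.γ_pos.ne']
  · refine Measure.ext_of_lintegral _ fun f hf => ?_
    have hmeas : Measurable fun y : S × Vec m => ∫⁻ g, f (M.γ • g) ∂(shift ζ.ker y) :=
      Measurable.lintegral_kernel (by fun_prop)
    rw [lintegral_shift _ x hf, M.lintegral_bellman π ζ hT (by fun_prop),
      lintegral_map hf (by fun_prop), RetDist.mixture,
      Measure.lintegral_bind (Kernel.aemeasurable _) (by fun_prop),
      M.lintegral_step π x hmeas]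
    refine lintegral_congr fun a => lintegral_congr fun y => ?_
    rw [lintegral_shift _ _ (by fun_prop)]
    refine lintegral_congr fun g => ?_
    rw [smul_add, smul_inv_smul₀ M.γ_pos.ne', add_assoc]

theorem enorm_γ : ‖M.γ‖ₑ = ENNReal.ofReal M.γ := by
  rw [← ofReal_norm, Real.norm_of_nonneg M.γ_pos.le]

theorem moment_bellman_le (π : StatPolicy S A m) (ζ : RetDist S m) (x : S × Vec m) :
    moment (M.bellman π ζ x) ≤ M.rewardBound + ENNReal.ofReal M.γ * ζ.bound := by
  by_cases hT : M.IsTerminal x.1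
  · simp [M.bellman_of_isTerminal π ζ hT]
  · rw [moment, M.lintegral_bellman π ζ hT measurable_l1]
    have h : ∀ a, ∫⁻ y, ∫⁻ g, l1 (y.1 + M.γ • g) ∂(ζ.ker (y.2, M.γ⁻¹ • (x.2 + y.1)))
        ∂(M.P (x, a)) ≤ M.rewardBound + ENNReal.ofReal M.γ * ζ.bound := fun a => by
      calc _ ≤ ∫⁻ y, (l1 y.1 + ENNReal.ofReal M.γ * ζ.bound) ∂(M.P (x, a)) := by
            refine lintegral_mono fun y => ?_
            refine (lintegral_mono fun g => l1_add_le _ _).trans ?_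
            rw [lintegral_add_left measurable_const, lintegral_const, measure_univ, mul_one]
            gcongr
            simp_rw [l1_smul]
            rw [lintegral_const_mul _ measurable_l1, M.enorm_γ]
            gcongr
            exact ζ.moment_le _
        _ ≤ _ := by
            rw [lintegral_add_right _ measurable_const, lintegral_const, measure_univ, mul_one]
            gcongr
            exact M.lintegral_reward_le _
    exact (lintegral_mono h).trans_eq (by simp)

/-- The Bellman operator as a map on return distribution functions. -/
noncomputable def bellmanRet (π : StatPolicy S A m) (ζ : RetDist S m) : RetDist S m :=
  RetDist.ofKernel (M.bellman π ζ) (B := M.rewardBound + ENNReal.ofReal M.γ * ζ.bound)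
    (ENNReal.add_lt_top.2 ⟨M.rewardBound_lt_top, ENNReal.mul_lt_top (by simp) ζ.bound_lt_top⟩)
    (M.moment_bellman_le π ζ)

@[simp]
theorem bellmanRet_ker (π : StatPolicy S A m) (ζ : RetDist S m) :
    (M.bellmanRet π ζ).ker = M.bellman π ζ := rfl

theorem zeroAtTerminal_bellmanRet (π : StatPolicy S A m) (ζ : RetDist S m) :
    M.ZeroAtTerminal (M.bellmanRet π ζ) :=
  fun s c hs => M.bellman_of_isTerminal π ζ (x := (s, c)) hs

theorem lintegral_stock_step_lt_top (π : StatPolicy S A m) (x : S × Vec m) :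
    ∫⁻ y, l1 y.2 ∂(M.step π x) < ⊤ :=
  (M.lintegral_stock_step_le π x).trans_lt (ENNReal.mul_lt_top (by simp)
    (ENNReal.add_lt_top.2 ⟨l1_lt_top _, M.rewardBound_lt_top⟩))

/-- Monotonicity of the Bellman operator in the objective. -/
theorem objective_bellman_le {K : P1 m → ℝ} (hmix : IndifferentToMixtures S K)
    (hdisc : IndifferentToDiscount M.γ K) (π : StatPolicy S A m) {ζ ζ' : RetDist S m}
    {x : S × Vec m}
    (hle : ∀ᵐ y ∂(M.step π x), objective K ζ'.ker y ≤ objective K ζ.ker y) :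
    objective K (M.bellman π ζ') x ≤ objective K (M.bellman π ζ) x := by
  by_cases hT : M.IsTerminal x.1
  · rw [objective, objective, M.bellman_of_isTerminal π ζ hT, M.bellman_of_isTerminal π ζ' hT]
  · have hμ := M.lintegral_stock_step_lt_top π x
    rw [objective_eq, objective_eq, M.shift_bellman π ζ (Or.inl hT),
      M.shift_bellman π ζ' (Or.inl hT)]
    exact hdisc.ev_map_le (ζ.inP1_mixture _ hμ) (ζ'.inP1_mixture _ hμ)
      (hmix.mixture_le ζ ζ' _ hμ hle)

/-- The Bellman operator is a `γ`-contraction for the supremum Wasserstein distance. -/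
theorem wass_bellman_le (π : StatPolicy S A m) {ζ ζ' : RetDist S m} {D : ℝ≥0∞}
    (hD : ∀ y, wass (ζ.ker y) (ζ'.ker y) ≤ D) (x : S × Vec m) :
    wass (M.bellman π ζ x) (M.bellman π ζ' x) ≤ ENNReal.ofReal M.γ * D := by
  by_cases hT : M.IsTerminal x.1
  · rw [M.bellman_of_isTerminal π ζ hT, M.bellman_of_isTerminal π ζ' hT, wass_dirac_zero]
    simp
  · have hunshift : ∀ ζ : RetDist S m, M.bellman π ζ x =
        ((ζ.mixture (M.step π x)).map (fun g => M.γ • g)).map (fun g => -x.2 + g) := fun ζ => by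
      rw [← M.shift_bellman π ζ (Or.inl hT), shift_apply,
        Measure.map_map (by fun_prop) (by fun_prop)]
      simp [Function.comp_def]
    have hμ := M.lintegral_stock_step_lt_top π x
    rw [hunshift ζ, hunshift ζ']
    refine (wass_map_add _ _ _).trans ((wass_map_le (c := ENNReal.ofReal M.γ) (by fun_prop)
      (by simpa using M.γ_pos) (by simp) (fun y z => ?_) _ _).trans ?_)
    · rw [← smul_sub, l1_smul, M.enorm_γ]
    · gcongr
      refine wass_bind_le _ _ _ (ζ.inP1_mixture _ hμ).moment_lt_top
        (ζ'.inP1_mixture _ hμ).moment_lt_top fun y => ?_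
      rw [shift_apply, shift_apply]
      exact (wass_map_add _ _ _).trans (hD y)

end MDP

end OneStep

/-! ### Iterating the Bellman operator along a Markov policy -/

section Iterate

variable {S A : Type*} [MeasurableSpace S] [MeasurableSpace A] {m : ℕ}

/-- The family constantly equal to `δ₀` as a return distribution function. -/
noncomputable def zeroRet (S : Type*) [MeasurableSpace S] (m : ℕ) : RetDist S m :=
  RetDist.ofKernel (Kernel.const _ (Measure.dirac 0)) (B := 0) ENNReal.zero_lt_top (by simp)

theorem RetDist.mixture_of_ae_eq_dirac (ζ : RetDist S m) {μ : Measure (S × Vec m)}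
    (h : ∀ᵐ y ∂μ, ζ.ker y = Measure.dirac 0) : ζ.mixture μ = μ.map Prod.snd := by
  have h1 : ∀ᵐ y ∂μ, shift ζ.ker y = Measure.dirac y.2 := by
    filter_upwards [h] with y hy
    rw [shift_apply, hy, Measure.map_dirac' (by fun_prop), add_zero]
  rw [RetDist.mixture, Measure.bind_congr_right h1]
  exact Measure.bind_dirac_eq_map μ measurable_snd

namespace MDP

variable (M : MDP S A m)

/-- The composition `T_{σ 0} T_{σ 1} ⋯ T_{σ (n - 1)} ζ` of Bellman operators. -/
noncomputable def iter (σ : MarkovPolicy S A m) : ℕ → RetDist S m → RetDist S m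
  | 0, ζ => ζ
  | n + 1, ζ => iter σ n (M.bellmanRet (σ n) ζ)

/-- The law of `(S_n, C_n)` as a function of the initial augmented state, under a Markov policy. -/
noncomputable def steps (σ : MarkovPolicy S A m) : ℕ → Kernel (S × Vec m) (S × Vec m)
  | 0 => Kernel.id
  | n + 1 => M.step (σ n) ∘ₖ steps σ n

instance isMarkovKernel_steps (σ : MarkovPolicy S A m) : ∀ n, IsMarkovKernel (M.steps σ n)
  | 0 => by unfold steps; infer_instance
  | n + 1 => by
    have := isMarkovKernel_steps σ n
    unfold steps; infer_instance

theorem steps_zero_apply (σ : MarkovPolicy S A m) (x : S × Vec m) :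
    M.steps σ 0 x = Measure.dirac x := Kernel.id_apply x

theorem steps_succ_apply (σ : MarkovPolicy S A m) (n : ℕ) (x : S × Vec m) :
    M.steps σ (n + 1) x = (M.steps σ n x).bind (M.step (σ n)) := Kernel.comp_apply _ _ _

/-- Decomposition of the law of the augmented states according to the first step. -/
theorem steps_succ_eq_comp_step (σ : MarkovPolicy S A m) (n : ℕ) :
    M.steps σ (n + 1) = M.steps (fun i => σ (i + 1)) n ∘ₖ M.step (σ 0) := by
  induction n with
  | zero => simp [steps]
  | succ n ih =>
    rw [show M.steps σ (n + 1 + 1) = M.step (σ (n + 1)) ∘ₖ M.steps σ (n + 1) from rfl, ih,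
      ← Kernel.comp_assoc]
    rfl

theorem mixture_bellmanRet (π : StatPolicy S A m) {ζ : RetDist S m} (hζ : M.ZeroAtTerminal ζ)
    (μ : Measure (S × Vec m)) :
    (M.bellmanRet π ζ).mixture μ = (ζ.mixture (μ.bind (M.step π))).map (fun g => M.γ • g) := by
  refine Measure.ext_of_lintegral _ fun f hf => ?_
  have hmeas : Measurable fun y => ∫⁻ g, f (M.γ • g) ∂(shift ζ.ker y) :=
    Measurable.lintegral_kernel (by fun_prop)
  rw [RetDist.mixture, Measure.lintegral_bind (Kernel.aemeasurable _) hf.aemeasurable,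
    lintegral_map hf (by fun_prop), RetDist.mixture,
    Measure.lintegral_bind (Kernel.aemeasurable _) (by fun_prop),
    Measure.lintegral_bind (Kernel.aemeasurable _) hmeas.aemeasurable]
  refine lintegral_congr fun x => ?_
  rw [bellmanRet_ker, M.shift_bellman π ζ (Or.inr hζ), lintegral_map hf (by fun_prop),
    RetDist.mixture, Measure.lintegral_bind (Kernel.aemeasurable _) (by fun_prop)]

/-- Up to the factor `γ ^ n`, the law of `c` plus the `n`-step return is a mixture over the
augmented state at time `n`. -/
theorem shift_iter (σ : MarkovPolicy S A m) (n : ℕ) {ζ : RetDist S m}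
    (hζ : M.ZeroAtTerminal ζ) (x : S × Vec m) :
    shift (M.iter σ n ζ).ker x =
      (ζ.mixture (M.steps σ n x)).map (fun g => M.γ ^ n • g) := by
  induction n generalizing ζ with
  | zero => simp [iter, steps_zero_apply, RetDist.mixture_dirac]
  | succ n ih =>
    rw [iter, ih (M.zeroAtTerminal_bellmanRet _ _), M.mixture_bellmanRet _ hζ,
      Measure.map_map (by fun_prop) (by fun_prop), steps_succ_apply]
    simp only [Function.comp_def, smul_smul, pow_succ]

theorem shift_iter_of_ae_eq_dirac (σ : MarkovPolicy S A m) (n : ℕ) {ζ : RetDist S m}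
    (hζ : M.ZeroAtTerminal ζ) {x : S × Vec m}
    (h : ∀ᵐ y ∂(M.steps σ n x), ζ.ker y = Measure.dirac 0) :
    shift (M.iter σ n ζ).ker x = (M.steps σ n x).map (fun y => M.γ ^ n • y.2) := by
  rw [M.shift_iter σ n hζ, ζ.mixture_of_ae_eq_dirac h,
    Measure.map_map (by fun_prop) (by fun_prop)]
  rfl

theorem zeroAtTerminal_zeroRet : M.ZeroAtTerminal (zeroRet S m) := fun _ _ _ => rfl

theorem shift_iter_zeroRet (σ : MarkovPolicy S A m) (n : ℕ) (x : S × Vec m) :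
    shift (M.iter σ n (zeroRet S m)).ker x =
      (M.steps σ n x).map (fun y => M.γ ^ n • y.2) :=
  M.shift_iter_of_ae_eq_dirac σ n M.zeroAtTerminal_zeroRet (Filter.Eventually.of_forall
    fun _ => rfl)

theorem objective_iter_le {K : P1 m → ℝ} (hmix : IndifferentToMixtures S K)
    (hdisc : IndifferentToDiscount M.γ K) (σ : MarkovPolicy S A m) (n : ℕ) {ζ ζ' : RetDist S m}
    (hle : ∀ y, objective K ζ'.ker y ≤ objective K ζ.ker y) (x : S × Vec m) :
    objective K (M.iter σ n ζ').ker x ≤ objective K (M.iter σ n ζ).ker x := by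
  induction n generalizing ζ ζ' with
  | zero => exact hle x
  | succ n ih =>
    exact ih fun y => M.objective_bellman_le hmix hdisc (σ n)
      (Filter.Eventually.of_forall hle)

theorem objective_iter_congr {K : P1 m → ℝ} (hmix : IndifferentToMixtures S K)
    (hdisc : IndifferentToDiscount M.γ K) (σ : MarkovPolicy S A m) (n : ℕ) {ζ ζ' : RetDist S m}
    (h : ∀ y, objective K ζ'.ker y = objective K ζ.ker y) (x : S × Vec m) :
    objective K (M.iter σ n ζ').ker x = objective K (M.iter σ n ζ).ker x :=
  le_antisymm (M.objective_iter_le hmix hdisc σ n (fun y => (h y).le) x)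
    (M.objective_iter_le hmix hdisc σ n (fun y => (h y).ge) x)

theorem wass_iter_le (σ : MarkovPolicy S A m) (n : ℕ) {ζ ζ' : RetDist S m} {D : ℝ≥0∞}
    (hD : ∀ y, wass (ζ.ker y) (ζ'.ker y) ≤ D) (x : S × Vec m) :
    wass ((M.iter σ n ζ).ker x) ((M.iter σ n ζ').ker x) ≤ ENNReal.ofReal M.γ ^ n * D := by
  induction n generalizing ζ ζ' D with
  | zero => simpa [iter] using hD x
  | succ n ih =>
    rw [pow_succ, mul_assoc]
    exact ih fun y => M.wass_bellman_le (σ n) hD y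

/-- Shifting the index: the first `n` policies of `σ` act on the result of the next `k`. -/
theorem iter_add (σ : MarkovPolicy S A m) (n k : ℕ) (ζ : RetDist S m) :
    M.iter σ (n + k) ζ = M.iter σ n (M.iter (fun i => σ (n + i)) k ζ) := by
  induction k generalizing ζ with
  | zero => rfl
  | succ k ih => rw [← add_assoc, iter, ih]; rfl

end MDP

end Iterate

/-! ### Trajectories -/

theorem map_eval_zero_trajMeasure {X : ℕ → Type*} [∀ n, MeasurableSpace (X n)]
    (μ₀ : Measure (X 0)) (κ : (n : ℕ) → Kernel ((i : Finset.Iic n) → X i) (X (n + 1)))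
    [∀ n, IsMarkovKernel (κ n)] :
    (Kernel.trajMeasure μ₀ κ).map (fun ω => ω 0) = μ₀ := by
  have h1 : (Kernel.trajMeasure μ₀ κ).map (Preorder.frestrictLe 0) =
      μ₀.map (MeasurableEquiv.piUnique fun i : Finset.Iic 0 => X i).symm := by
    rw [Kernel.trajMeasure, Measure.map_comp _ _ (by fun_prop), Kernel.traj_map_frestrictLe,
      Kernel.partialTraj_self, Measure.id_comp]
    rfl
  have h2 := congrArg (Measure.map (MeasurableEquiv.piUnique fun i : Finset.Iic 0 => X i)) h1
  rw [Measure.map_map (by fun_prop) (by fun_prop)] at h2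
  exact h2.trans
    (MeasurableEquiv.map_map_symm (MeasurableEquiv.piUnique fun i : Finset.Iic 0 => X i))

section Trajectories

variable {S A : Type*} [MeasurableSpace S] [MeasurableSpace A] {m : ℕ}

/-- The history up to time `n` along a trajectory started in `x`. -/
def histAt (x : S × Vec m) (n : ℕ) (ω : ℕ → Step S A m) : Hist S A m n := (x, fun i => ω i)

@[fun_prop]
theorem measurable_histAt (x : S × Vec m) (n : ℕ) :
    Measurable (histAt (A := A) x n) := by
  unfold histAt; fun_prop

theorem last_histAt {S A : Type*} (x : S × Vec m) (n : ℕ) (ω : ℕ → Step S A m) :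
    (histAt x n ω).last = MDP.stateAt x ω n := by
  cases n <;> rfl

@[fun_prop]
theorem measurable_stateAt (x : S × Vec m) (n : ℕ) :
    Measurable fun ω : ℕ → Step S A m => MDP.stateAt x ω n := by
  cases n with
  | zero => exact measurable_const
  | succ n =>
    have : Measurable fun ω : ℕ → Step S A m => (ω n).2.2 := by fun_prop
    exact this

namespace MDP

variable (M : MDP S A m) (π : HistPolicy S A m) (x : S × Vec m)

instance : IsProbabilityMeasure (M.trajLaw π x) := by unfold trajLaw; infer_instance

theorem lintegral_trajLaw (n : ℕ) {F : Hist S A m n × Step S A m → ℝ≥0∞} (hF : Measurable F) :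
    ∫⁻ ω, F (histAt x n ω, ω n) ∂(M.trajLaw π x) =
      ∫⁻ ω, ∫⁻ z, F (histAt x n ω, z) ∂(M.stepKernel π n (histAt x n ω)) ∂(M.trajLaw π x) := by
  cases n with
  | zero =>
    have h0 : ∀ ω : ℕ → Step S A m, histAt x 0 ω = (x, Fin.elim0) := fun ω =>
      Prod.ext rfl (Subsingleton.elim _ _)
    simp_rw [h0]
    have hF' : Measurable fun z => F ((x, Fin.elim0), z) := by fun_prop
    rw [lintegral_const, measure_univ, mul_one,
      ← lintegral_map (μ := M.trajLaw π x) hF' (measurable_pi_apply 0), trajLaw]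
    exact congrArg (fun ν => ∫⁻ z, F ((x, Fin.elim0), z) ∂ν)
      (map_eval_zero_trajMeasure (X := fun _ => Step S A m) _ _)
  | succ n =>
    have h := Kernel.map_frestrictLe_trajMeasure_compProd_eq_map_trajMeasure
      (X := fun _ => Step S A m) (μ₀ := M.stepKernel π 0 (x, Fin.elim0))
      (κ := fun n => (M.stepKernel π (n + 1)).comap (toHistory x n) (measurable_toHistory x n))
      (a := n)
    have hG : Measurable fun p : ((i : Finset.Iic n) → Step S A m) × Step S A m =>
        F (toHistory x n p.1, p.2) :=
      hF.comp (((measurable_toHistory x n).comp measurable_fst).prodMk measurable_snd)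
    have h2 := congrArg (fun ν => ∫⁻ p, F (toHistory x n p.1, p.2) ∂ν) h
    rw [lintegral_map hG (by fun_prop), Measure.lintegral_compProd hG,
      lintegral_map (Measurable.lintegral_kernel_prod_right' hG) (by fun_prop)] at h2
    exact h2.symm

theorem lintegral_stepKernel (n : ℕ) (h : Hist S A m n) {f : Step S A m → ℝ≥0∞}
    (hf : Measurable f) : ∫⁻ z, f z ∂(M.stepKernel π n h) =
      ∫⁻ a, ∫⁻ y, f (a, (y.1, (y.2, M.γ⁻¹ • (h.last.2 + y.1)))) ∂(M.P (h.last, a))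
        ∂(π.act n h) := by
  rw [stepKernel, Kernel.lintegral_compProd _ _ _ hf]
  exact lintegral_congr fun a => M.lintegral_aug h.last a (f := fun y => f (a, y)) (by fun_prop)

/-- A property of the history and the next step holds almost surely if it holds almost surely for
the reward and state drawn from `P`, whatever the action. -/
theorem ae_trajLaw (n : ℕ) {p : Hist S A m n × Step S A m → Prop} (hp : MeasurableSet {z | p z})
    (h : ∀ᵐ ω ∂(M.trajLaw π x), ∀ a, ∀ᵐ y ∂(M.P (stateAt x ω n, a)),
      p (histAt x n ω, (a, (y.1, (y.2, M.γ⁻¹ • ((stateAt x ω n).2 + y.1)))))) :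
    ∀ᵐ ω ∂(M.trajLaw π x), p (histAt x n ω, ω n) := by
  classical
  have hF : Measurable ({z | p z}ᶜ.indicator (1 : Hist S A m n × Step S A m → ℝ≥0∞)) :=
    measurable_one.indicator hp.compl
  have hz := M.lintegral_trajLaw π x n hF
  have h0 : ∫⁻ ω, ∫⁻ z, {z | p z}ᶜ.indicator (1 : Hist S A m n × Step S A m → ℝ≥0∞)
      (histAt x n ω, z) ∂(M.stepKernel π n (histAt x n ω)) ∂(M.trajLaw π x) = 0 := by
    rw [← lintegral_zero (μ := M.trajLaw π x)]
    refine lintegral_congr_ae ?_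
    filter_upwards [h] with ω hω
    rw [M.lintegral_stepKernel π n _ (f := fun z => {z | p z}ᶜ.indicator
      (1 : Hist S A m n × Step S A m → ℝ≥0∞) (histAt x n ω, z)) (by fun_prop)]
    rw [← lintegral_zero (μ := π.act n (histAt x n ω))]
    refine lintegral_congr fun a => ?_
    rw [last_histAt, ← lintegral_zero (μ := M.P (stateAt x ω n, a))]
    refine lintegral_congr_ae ?_
    filter_upwards [hω a] with y hy
    exact Set.indicator_of_notMem (s := {z | p z}ᶜ) (fun hc => hc hy) _
  rw [h0] at hz
  have hz' := (lintegral_eq_zero_iff (f := fun ω => {z | p z}ᶜ.indicator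
    (1 : Hist S A m n × Step S A m → ℝ≥0∞) (histAt x n ω, ω n)) (by fun_prop)).1 hz
  filter_upwards [hz'] with ω hω
  by_contra hc
  simp [hc] at hω

/-- The stock equation `C_{n+1} = γ⁻¹ (C_n + R_{n+1})`. -/
theorem ae_stock_succ (n : ℕ) : ∀ᵐ ω ∂(M.trajLaw π x),
    (ω n).2.2.2 = M.γ⁻¹ • ((stateAt x ω n).2 + (ω n).2.1) := by
  have hlast := Hist.measurable_last (S := S) (A := A) (m := m) (n := n)
  have h := M.ae_trajLaw π x n (p := fun z => z.2.2.2.2 = M.γ⁻¹ • (z.1.last.2 + z.2.2.1))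
    (measurableSet_eq_fun (by fun_prop) (by fun_prop))
    (Filter.Eventually.of_forall fun ω a => Filter.Eventually.of_forall fun y => by
      simp only [last_histAt])
  simpa only [last_histAt] using h

/-- The stock accumulates the rewards: `c + ∑_{t < n} γ ^ t R_{t+1} = γ ^ n C_n`. -/
theorem ae_partialReturn_eq : ∀ᵐ ω ∂(M.trajLaw π x), ∀ n,
    x.2 + ∑ t ∈ Finset.range n, M.γ ^ t • (ω t).2.1 = M.γ ^ n • (stateAt x ω n).2 := by
  filter_upwards [ae_all_iff.2 fun n => M.ae_stock_succ π x n] with ω hω n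
  induction n with
  | zero => simp [stateAt]
  | succ n ih =>
    have h1 : (stateAt x ω (n + 1)).2 = M.γ⁻¹ • ((stateAt x ω n).2 + (ω n).2.1) := hω n
    rw [Finset.sum_range_succ, ← add_assoc, ih, h1, pow_succ, mul_smul,
      smul_inv_smul₀ M.γ_pos.ne', smul_add]

theorem lintegral_reward_trajLaw_le (n : ℕ) :
    ∫⁻ ω, l1 (ω n).2.1 ∂(M.trajLaw π x) ≤ M.rewardBound := by
  have h := M.lintegral_trajLaw π x n (F := fun z => l1 z.2.2.1) (by fun_prop)
  simp only at h
  rw [h]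
  have hb : ∀ ω, ∫⁻ z, l1 z.2.1 ∂(M.stepKernel π n (histAt x n ω)) ≤ M.rewardBound := fun ω => by
    rw [M.lintegral_stepKernel π n _ (f := fun z => l1 z.2.1) (by fun_prop)]
    exact (lintegral_mono fun a => M.lintegral_reward_le _).trans_eq (by simp)
  exact (lintegral_mono hb).trans_eq (by simp)

/-- Once a terminal state is reached, it is kept and the rewards vanish. -/
theorem ae_terminal_succ {n : ℕ}
    (h : ∀ᵐ ω ∂(M.trajLaw π x), M.IsTerminal (stateAt x ω n).1) :
    ∀ᵐ ω ∂(M.trajLaw π x), (ω n).2.1 = 0 ∧ M.IsTerminal (stateAt x ω (n + 1)).1 := by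
  have hT : MeasurableSet {z : Hist S A m n × Step S A m | M.IsTerminal z.2.2.2.1} :=
    M.measurableSet_terminal.preimage
      (f := fun z : Hist S A m n × Step S A m => z.2.2.2.1) (by fun_prop)
  refine M.ae_trajLaw π x n (p := fun z => z.2.2.1 = 0 ∧ M.IsTerminal z.2.2.2.1)
    ((measurableSet_eq_fun (by fun_prop) measurable_const).inter hT) ?_
  filter_upwards [h] with ω hω a
  have hP : M.P (stateAt x ω n, a) = Measure.dirac (0, (stateAt x ω n).1) := hω _ a
  rw [hP]
  have hm : MeasurableSet {y : Vec m × S | y.1 = 0 ∧ M.IsTerminal y.2} :=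
    (measurableSet_eq_fun measurable_fst measurable_const).inter
      (M.measurableSet_terminal.preimage measurable_snd)
  exact (ae_dirac_iff hm).2 ⟨rfl, hω⟩

theorem TerminatesBy.ae_terminal {M : MDP S A m} {N : ℕ} (hN : M.TerminatesBy N)
    (π : HistPolicy S A m) (x : S × Vec m) {n : ℕ} (hn : N ≤ n) :
    ∀ᵐ ω ∂(M.trajLaw π x), M.IsTerminal (stateAt x ω n).1 := by
  induction n, hn using Nat.le_induction with
  | base => exact hN π x
  | succ n hn ih => exact (M.ae_terminal_succ π x ih).mono fun ω h => h.2

theorem TerminatesBy.ae_discountedReturn_eq {M : MDP S A m} {N : ℕ} (hN : M.TerminatesBy N)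
    (π : HistPolicy S A m) (x : S × Vec m) {n : ℕ} (hn : N ≤ n) :
    ∀ᵐ ω ∂(M.trajLaw π x),
      M.discountedReturn ω = ∑ t ∈ Finset.range n, M.γ ^ t • (ω t).2.1 := by
  have h : ∀ᵐ ω ∂(M.trajLaw π x), ∀ k, n ≤ k → (ω k).2.1 = 0 := by
    refine ae_all_iff.2 fun k => ?_
    by_cases hk : n ≤ k
    · filter_upwards [M.ae_terminal_succ π x (hN.ae_terminal π x (hn.trans hk))] with ω hω _
      exact hω.1
    · exact Filter.Eventually.of_forall fun ω h => absurd h hk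
  filter_upwards [h] with ω hω
  refine tsum_eq_sum fun t ht => ?_
  rw [hω t (by simpa using ht), smul_zero]

theorem measurable_partialReturn (n : ℕ) : Measurable fun ω : ℕ → Step S A m =>
    ∑ t ∈ Finset.range n, M.γ ^ t • (ω t).2.1 := by
  fun_prop

theorem TerminatesBy.retDist_eq {M : MDP S A m} {N : ℕ} (hN : M.TerminatesBy N)
    (π : HistPolicy S A m) (x : S × Vec m) {n : ℕ} (hn : N ≤ n) :
    M.retDist π x =
      (M.trajLaw π x).map fun ω => ∑ t ∈ Finset.range n, M.γ ^ t • (ω t).2.1 :=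
  Measure.map_congr (hN.ae_discountedReturn_eq π x hn)

/-- The law of `c` plus the `n`-step return depends only on the law of the stock at time `n`. -/
theorem map_add_partialReturn (n : ℕ) :
    ((M.trajLaw π x).map fun ω => ∑ t ∈ Finset.range n, M.γ ^ t • (ω t).2.1).map
      (fun g => x.2 + g) =
    ((M.trajLaw π x).map fun ω => stateAt x ω n).map (fun y => M.γ ^ n • y.2) := by
  rw [Measure.map_map (by fun_prop) (by fun_prop), Measure.map_map (by fun_prop) (by fun_prop)]
  refine Measure.map_congr ?_
  filter_upwards [M.ae_partialReturn_eq π x] with ω hω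
  exact hω n

theorem lintegral_stateAt_succ (n : ℕ) {f : S × Vec m → ℝ≥0∞} (hf : Measurable f) :
    ∫⁻ ω, f (stateAt x ω (n + 1)) ∂(M.trajLaw π x) =
      ∫⁻ ω, ∫⁻ a, ∫⁻ y, f (y.2, M.γ⁻¹ • ((stateAt x ω n).2 + y.1)) ∂(M.P (stateAt x ω n, a))
        ∂(π.act n (histAt x n ω)) ∂(M.trajLaw π x) := by
  have h := M.lintegral_trajLaw π x n (F := fun z => f z.2.2.2) (by fun_prop)
  refine h.trans (lintegral_congr fun ω => ?_)
  simp only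
  rw [M.lintegral_stepKernel π n _ (f := fun z => f z.2.2) (by fun_prop), last_histAt]

theorem map_stateAt_zero : (M.trajLaw π x).map (fun ω => stateAt x ω 0) = Measure.dirac x := by
  simp [stateAt, Measure.map_const]

theorem map_stateAt_toHist (σ : MarkovPolicy S A m) (n : ℕ) :
    (M.trajLaw σ.toHist x).map (fun ω => stateAt x ω n) = M.steps σ n x := by
  induction n with
  | zero => rw [map_stateAt_zero, steps_zero_apply]
  | succ n ih =>
    refine Measure.ext_of_lintegral _ fun f hf => ?_
    have hmeas : Measurable fun y => ∫⁻ z, f z ∂(M.step (σ n) y) :=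
      Measurable.lintegral_kernel hf
    rw [lintegral_map hf (by fun_prop), M.lintegral_stateAt_succ _ x n hf, steps_succ_apply,
      Measure.lintegral_bind (Kernel.aemeasurable _) hf.aemeasurable, ← ih,
      lintegral_map hmeas (by fun_prop)]
    refine lintegral_congr fun ω => ?_
    rw [M.lintegral_step _ _ hf]
    simp only [MarkovPolicy.toHist, Kernel.comap_apply, last_histAt]

/-- Whatever the history-based policy, some Markov policy generates the same laws of the augmented
states: it draws the action from its conditional law given the current augmented state. -/
theorem exists_markovPolicy_map_stateAt_eq [StandardBorelSpace A] :
    ∃ σ : MarkovPolicy S A m, ∀ n,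
      (M.trajLaw π x).map (fun ω => stateAt x ω n) = M.steps σ n x := by
  have hA : Nonempty A := by
    by_contra h
    have := not_nonempty_iff.1 h
    have h1 := measure_univ (μ := π.act 0 (x, Fin.elim0))
    simp [univ_eq_empty_iff.2 this] at h1
  set ρ : ℕ → Measure ((S × Vec m) × A) := fun n =>
    (M.trajLaw π x).map fun ω => (stateAt x ω n, (ω n).1) with hρ
  have hρP : ∀ n, IsProbabilityMeasure (ρ n) := fun n =>
    Measure.isProbabilityMeasure_map (by fun_prop)
  refine ⟨fun n => ⟨(ρ n).condKernel, inferInstance⟩, fun n => ?_⟩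
  induction n with
  | zero => rw [map_stateAt_zero, steps_zero_apply]
  | succ n ih =>
    refine Measure.ext_of_lintegral _ fun f hf => ?_
    set G : (S × Vec m) × A → ℝ≥0∞ := fun z =>
      ∫⁻ y, f (y.2, M.γ⁻¹ • (z.1.2 + y.1)) ∂(M.P z) with hG_def
    have hG : Measurable G := by
      have : Measurable fun p : ((S × Vec m) × A) × (Vec m × S) =>
        f (p.2.2, M.γ⁻¹ • (p.1.1.2 + p.2.1)) := by fun_prop
      exact this.lintegral_kernel_prod_right'
    have hfst : (ρ n).fst = M.steps (fun n => ⟨(ρ n).condKernel, inferInstance⟩) n x := by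
      rw [← ih, Measure.fst, hρ, Measure.map_map measurable_fst (by fun_prop)]
      rfl
    have h1 : ∫⁻ ω, f (stateAt x ω (n + 1)) ∂(M.trajLaw π x) = ∫⁻ z, G z ∂(ρ n) := by
      rw [M.lintegral_stateAt_succ π x n hf, hρ, lintegral_map hG (by fun_prop)]
      have hlast := Hist.measurable_last (S := S) (A := A) (m := m) (n := n)
      have h := M.lintegral_trajLaw π x n (F := fun z => G (z.1.last, z.2.1)) (by fun_prop)
      simp only [last_histAt] at h
      rw [h]
      refine lintegral_congr fun ω => ?_
      rw [M.lintegral_stepKernel π n _ (f := fun z => G (stateAt x ω n, z.1)) (by fun_prop)]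
      simp [hG_def]
    have h2 : ∫⁻ z, G z ∂(ρ n) = ∫⁻ y, ∫⁻ a, G (y, a) ∂((ρ n).condKernel y) ∂(ρ n).fst := by
      conv_lhs => rw [← (ρ n).disintegrate (ρ n).condKernel]
      exact Measure.lintegral_compProd hG
    rw [lintegral_map hf (by fun_prop), h1, h2, steps_succ_apply,
      Measure.lintegral_bind (Kernel.aemeasurable _) hf.aemeasurable, ← hfst]
    refine lintegral_congr fun y => ?_
    rw [M.lintegral_step _ _ hf]

end MDP

end Trajectories

/-! ### Convergence of the discounted return -/

section Discounted

variable {S A : Type*} [MeasurableSpace S] [MeasurableSpace A] {m : ℕ}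

theorem l1_sum_le {ι : Type*} (s : Finset ι) (f : ι → Vec m) :
    l1 (∑ t ∈ s, f t) ≤ ∑ t ∈ s, l1 (f t) := by
  classical
  induction s using Finset.induction_on with
  | empty => simp
  | insert a s ha ih =>
    rw [Finset.sum_insert ha, Finset.sum_insert ha]
    exact (l1_add_le _ _).trans (by gcongr)

theorem continuous_l1 : Continuous (l1 : Vec m → ℝ≥0∞) := by
  unfold l1; fun_prop

theorem summable_of_tsum_l1_ne_top {f : ℕ → Vec m} (h : ∑' t, l1 (f t) ≠ ⊤) : Summable f :=
  .of_enorm (ne_top_of_le_ne_top h (ENNReal.tsum_le_tsum fun t => enorm_le_l1 (f t)))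

theorem l1_tsum_le {f : ℕ → Vec m} (h : Summable f) : l1 (∑' t, f t) ≤ ∑' t, l1 (f t) := by
  refine le_of_tendsto (continuous_l1.continuousAt.tendsto.comp h.hasSum.tendsto_sum_nat)
    (Filter.Eventually.of_forall fun n => ?_)
  exact (l1_sum_le _ _).trans (ENNReal.sum_le_tsum _)

namespace MDP

variable (M : MDP S A m) (π : HistPolicy S A m) (x : S × Vec m)

theorem l1_discounted (t : ℕ) (r : Vec m) :
    l1 (M.γ ^ t • r) = ENNReal.ofReal M.γ ^ t * l1 r := by
  rw [l1_smul, enorm_pow, M.enorm_γ]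

theorem lintegral_discounted_le (t : ℕ) :
    ∫⁻ ω, l1 (M.γ ^ t • (ω t).2.1) ∂(M.trajLaw π x) ≤
      ENNReal.ofReal M.γ ^ t * M.rewardBound := by
  simp_rw [M.l1_discounted]
  rw [lintegral_const_mul _ (by fun_prop)]
  gcongr
  exact M.lintegral_reward_trajLaw_le π x t

theorem moment_partialReturn_le (n : ℕ) :
    moment ((M.trajLaw π x).map fun ω => ∑ t ∈ Finset.range n, M.γ ^ t • (ω t).2.1) ≤
      n * M.rewardBound := by
  rw [moment, lintegral_map measurable_l1 (by fun_prop)]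
  refine (lintegral_mono fun ω => l1_sum_le _ _).trans ?_
  rw [lintegral_finsetSum _ (fun t _ => by fun_prop)]
  refine (Finset.sum_le_card_nsmul _ _ M.rewardBound fun t _ => ?_).trans_eq (by simp)
  refine (M.lintegral_discounted_le π x t).trans (mul_le_of_le_one_left' ?_)
  exact pow_le_one₀ (by simp) (by simpa using M.γ_le_one)

theorem TerminatesBy.isProbabilityMeasure_retDist {M : MDP S A m} {N : ℕ}
    (hN : M.TerminatesBy N) (π : HistPolicy S A m) (x : S × Vec m) :
    IsProbabilityMeasure (M.retDist π x) := by
  rw [hN.retDist_eq π x le_rfl]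
  exact Measure.isProbabilityMeasure_map (M.measurable_partialReturn N).aemeasurable

theorem TerminatesBy.wassSup_retDist_lt_top {M : MDP S A m} {N : ℕ} (hN : M.TerminatesBy N) :
    (⨆ π : HistPolicy S A m, wassSup (M.retDist π) (zeroDist (S × Vec m) m)) < ⊤ := by
  refine (iSup_le fun π => iSup_le fun x => ?_).trans_lt
    (ENNReal.mul_lt_top (ENNReal.natCast_lt_top N) M.rewardBound_lt_top)
  have := hN.isProbabilityMeasure_retDist π x
  rw [zeroDist, wass_dirac_zero, hN.retDist_eq π x le_rfl]
  exact M.moment_partialReturn_le π x N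

/-- The geometric bound `B / (1 - γ)` for the moments of returns. -/
noncomputable def returnBound : ℝ≥0∞ := M.rewardBound * (1 - ENNReal.ofReal M.γ)⁻¹

theorem returnBound_lt_top (hγ : M.γ < 1) : M.returnBound < ⊤ := by
  refine ENNReal.mul_lt_top M.rewardBound_lt_top ?_
  rw [ENNReal.inv_lt_top, tsub_pos_iff_lt]
  simpa using hγ

theorem lintegral_tail_le (n : ℕ) :
    ∫⁻ ω, ∑' t, l1 (M.γ ^ (t + n) • (ω (t + n)).2.1) ∂(M.trajLaw π x) ≤
      ENNReal.ofReal M.γ ^ n * M.returnBound := by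
  rw [lintegral_tsum (fun t => Measurable.aemeasurable (by fun_prop))]
  refine (ENNReal.tsum_le_tsum fun t => M.lintegral_discounted_le π x (t + n)).trans_eq ?_
  simp_rw [pow_add]
  rw [ENNReal.tsum_mul_right, ENNReal.tsum_mul_right, ENNReal.tsum_geometric, returnBound]
  ring

theorem ae_summable (hγ : M.γ < 1) : ∀ᵐ ω ∂(M.trajLaw π x),
    Summable fun t => M.γ ^ t • (ω t).2.1 := by
  have h := M.lintegral_tail_le π x 0
  have h1 : ∀ᵐ ω ∂(M.trajLaw π x), ∑' t, l1 (M.γ ^ (t + 0) • (ω (t + 0)).2.1) < ⊤ := by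
    refine ae_lt_top (by fun_prop) (h.trans_lt ?_).ne
    simpa using M.returnBound_lt_top hγ
  filter_upwards [h1] with ω hω
  exact summable_of_tsum_l1_ne_top hω.ne

theorem aemeasurable_discountedReturn (hγ : M.γ < 1) :
    AEMeasurable M.discountedReturn (M.trajLaw π x) := by
  refine aemeasurable_of_tendsto_metrizable_ae Filter.atTop
    (fun n => (M.measurable_partialReturn n).aemeasurable) ?_
  filter_upwards [M.ae_summable π x hγ] with ω hω
  exact hω.hasSum.tendsto_sum_nat

theorem isProbabilityMeasure_retDist (hγ : M.γ < 1) : IsProbabilityMeasure (M.retDist π x) :=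
  Measure.isProbabilityMeasure_map (M.aemeasurable_discountedReturn π x hγ)

/-- The laws of the partial returns converge geometrically to the law of the return. -/
theorem wass_partialReturn_le (hγ : M.γ < 1) (n : ℕ) :
    wass ((M.trajLaw π x).map fun ω => ∑ t ∈ Finset.range n, M.γ ^ t • (ω t).2.1)
      (M.retDist π x) ≤ ENNReal.ofReal M.γ ^ n * M.returnBound := by
  have hm := M.aemeasurable_discountedReturn π x hγ
  rw [retDist, Measure.map_congr hm.ae_eq_mk, wass_comm]
  refine (wass_map_map_le _ hm.measurable_mk (M.measurable_partialReturn n)).trans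
    (le_trans (lintegral_mono_ae ?_) (M.lintegral_tail_le π x n))
  filter_upwards [M.ae_summable π x hγ, hm.ae_eq_mk] with ω hω hmk
  rw [← hmk, discountedReturn, ← hω.sum_add_tsum_nat_add n, add_sub_cancel_left]
  exact l1_tsum_le ((summable_nat_add_iff n).2 hω)

end MDP

end Discounted

/-! ### Value iteration with finite horizon -/

section FiniteHorizon

variable {S A : Type*} [MeasurableSpace S] [MeasurableSpace A] {m : ℕ}

/-- The sequence `η` is generated by value iteration, with greedy policies `πbar`. -/
structure ValueIteration (M : MDP S A m) (K : P1 m → ℝ) (η : ℕ → RetDist S m)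
    (πbar : ℕ → StatPolicy S A m) : Prop where
  le : ∀ n (π : StatPolicy S A m) x,
    objective K (M.bellman π (η n)) x ≤ objective K (η (n + 1)).ker x
  greedy : ∀ n x, objective K (M.bellman (πbar n) (η n)) x = objective K (η (n + 1)).ker x

namespace ValueIteration

variable {M : MDP S A m} {K : P1 m → ℝ} {η : ℕ → RetDist S m} {πbar : ℕ → StatPolicy S A m}

theorem objective_iter_le (h : ValueIteration M K η πbar) (hmix : IndifferentToMixtures S K)
    (hdisc : IndifferentToDiscount M.γ K) (σ : MarkovPolicy S A m) (n k : ℕ) (x : S × Vec m) :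
    objective K (M.iter σ n (η k)).ker x ≤ objective K (η (n + k)).ker x := by
  induction n generalizing k with
  | zero => simp [MDP.iter]
  | succ n ih =>
    rw [Nat.succ_add_eq_add_succ]
    exact (M.objective_iter_le hmix hdisc σ n (h.le k (σ n)) x).trans (ih (k + 1))

/-- The greedy policies, applied in reverse order, attain the iterates. -/
theorem objective_iter_eq (h : ValueIteration M K η πbar) (hmix : IndifferentToMixtures S K)
    (hdisc : IndifferentToDiscount M.γ K) {σ : MarkovPolicy S A m} {n k : ℕ}
    (hσ : ∀ i < n, σ i = πbar (n + k - 1 - i)) (x : S × Vec m) :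
    objective K (M.iter σ n (η k)).ker x = objective K (η (n + k)).ker x := by
  induction n generalizing k with
  | zero => simp [MDP.iter]
  | succ n ih =>
    have h1 : σ n = πbar k := by rw [hσ n n.lt_succ_self]; congr 1; omega
    rw [Nat.succ_add_eq_add_succ, ← ih (k := k + 1) fun i hi => by
      rw [hσ i (hi.trans n.lt_succ_self)]; congr 1; omega]
    refine M.objective_iter_congr hmix hdisc σ n (fun y => ?_) x
    rw [h1]
    exact h.greedy k y

/-- The iterates may be replaced by Bellman images, which vanish at terminal states. -/
theorem bellmanRet (h : ValueIteration M K η πbar) (hmix : IndifferentToMixtures S K)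
    (hdisc : IndifferentToDiscount M.γ K) :
    ValueIteration M K (fun n => M.bellmanRet (πbar n) (η n)) (fun n => πbar (n + 1)) := by
  have hc : ∀ n (π : StatPolicy S A m) x,
      objective K (M.bellman π (M.bellmanRet (πbar n) (η n))) x =
        objective K (M.bellman π (η (n + 1))) x := fun n π x =>
    le_antisymm
      (M.objective_bellman_le hmix hdisc π (.of_forall fun y => (h.greedy n y).le))
      (M.objective_bellman_le hmix hdisc π (.of_forall fun y => (h.greedy n y).ge))
  refine ⟨fun n π x => ?_, fun n x => ?_⟩
  · rw [hc, MDP.bellmanRet_ker, h.greedy (n + 1)]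
    exact h.le (n + 1) π x
  · rw [hc, MDP.bellmanRet_ker]

end ValueIteration

namespace MDP

variable {M : MDP S A m} {K : P1 m → ℝ}

theorem objective_iter_eq_of_ae_terminal (σ : MarkovPolicy S A m) (n : ℕ) {ζ : RetDist S m}
    (hζ : M.ZeroAtTerminal ζ) {x : S × Vec m}
    (h : ∀ᵐ y ∂(M.steps σ n x), M.IsTerminal y.1) :
    objective K (M.iter σ n ζ).ker x =
      ev K ((M.steps σ n x).map (fun y => M.γ ^ n • y.2)) := by
  rw [objective_eq, M.shift_iter_of_ae_eq_dirac σ n hζ (h.mono fun y hy => hζ y.1 y.2 hy)]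

theorem TerminatesBy.ae_steps {N : ℕ} (hN : M.TerminatesBy N) (σ : MarkovPolicy S A m)
    (x : S × Vec m) {n : ℕ} (hn : N ≤ n) : ∀ᵐ y ∂(M.steps σ n x), M.IsTerminal y.1 := by
  have hm : MeasurableSet {y : S × Vec m | M.IsTerminal y.1} :=
    M.measurableSet_terminal.preimage measurable_fst
  rw [← M.map_stateAt_toHist x σ n, ae_map_iff (by fun_prop) hm]
  exact hN.ae_terminal _ x hn

/-- With finite horizon, the objective of the return is computed by finitely many Bellman
operators, applied along any Markov policy with the same laws of the augmented states. -/
theorem TerminatesBy.objective_retDist_eq {N : ℕ} (hN : M.TerminatesBy N)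
    (π : HistPolicy S A m) (x : S × Vec m) {n : ℕ} (hn : N ≤ n) {σ : MarkovPolicy S A m}
    (hσ : (M.trajLaw π x).map (fun ω => stateAt x ω n) = M.steps σ n x) {ζ : RetDist S m}
    (hζ : M.ZeroAtTerminal ζ) :
    objective K (M.retDist π) x = objective K (M.iter σ n ζ).ker x := by
  rw [objective, hN.retDist_eq π x hn, M.map_add_partialReturn π x n, hσ,
    objective_iter_eq_of_ae_terminal σ n hζ (hN.ae_steps σ x hn)]

theorem TerminatesBy.isLUB_objective [StandardBorelSpace A] {N : ℕ} (hN : M.TerminatesBy N)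
    (hmix : IndifferentToMixtures S K) (hdisc : IndifferentToDiscount M.γ K)
    {η : ℕ → RetDist S m} {πbar : ℕ → StatPolicy S A m} (h : ValueIteration M K η πbar)
    (h0 : M.ZeroAtTerminal (η 0)) {n : ℕ} (hn : N ≤ n) (x : S × Vec m) :
    IsLUB (range fun π : HistPolicy S A m => objective K (M.retDist π) x)
      (objective K (η n).ker x) := by
  refine ⟨?_, fun b hb => ?_⟩
  · rintro _ ⟨π, rfl⟩
    obtain ⟨σ, hσ⟩ := M.exists_markovPolicy_map_stateAt_eq π x
    exact (hN.objective_retDist_eq π x hn (hσ n) h0).trans_le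
      (h.objective_iter_le hmix hdisc σ n 0 x)
  · -- the greedy policies in reverse order attain the supremum
    set σ : MarkovPolicy S A m := fun i => πbar (n - 1 - i)
    have h1 : objective K (M.iter σ n (η 0)).ker x = objective K (η n).ker x :=
      h.objective_iter_eq hmix hdisc (k := 0) (fun i _ => rfl) x
    rw [← h1, ← hN.objective_retDist_eq σ.toHist x hn (M.map_stateAt_toHist x σ n) h0]
    exact hb ⟨σ.toHist, rfl⟩

/-- A stationary policy whose Bellman operator preserves the objective of `ζ` has the objective of
`ζ`. -/
theorem TerminatesBy.objective_stationary_eq {N : ℕ} (hN : M.TerminatesBy N)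
    (hmix : IndifferentToMixtures S K) (hdisc : IndifferentToDiscount M.γ K)
    (π : StatPolicy S A m) {ζ : RetDist S m} (hζ : M.ZeroAtTerminal ζ)
    (hfix : ∀ y, objective K (M.bellman π ζ) y = objective K ζ.ker y) (x : S × Vec m) :
    objective K (M.retDist π.toHist) x = objective K ζ.ker x := by
  have hiter : ∀ k, objective K (M.iter (fun _ => π) k ζ).ker x = objective K ζ.ker x := fun k => by
    induction k with
    | zero => rfl
    | succ k ih => exact (M.objective_iter_congr hmix hdisc _ k hfix x).trans ih
  rw [StatPolicy.toHist,
    hN.objective_retDist_eq _ x le_rfl (M.map_stateAt_toHist x (fun _ => π) N) hζ, hiter]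

/-- If the process terminates within `N + 1` steps, then after one step almost surely at most `N`
steps remain. There `η N` has an objective attained by `N` Bellman operators, to which one more
operator may be added without changing it, so it is at most that of `η (N + 1)`. -/
theorem TerminatesBy.le_objective_bellman_horizon {N : ℕ} (hN : M.TerminatesBy (N + 1))
    (hmix : IndifferentToMixtures S K) (hdisc : IndifferentToDiscount M.γ K)
    {η : ℕ → RetDist S m} {πbar : ℕ → StatPolicy S A m} (h : ValueIteration M K η πbar)
    (h0 : M.ZeroAtTerminal (η 0)) (π : StatPolicy S A m) (x : S × Vec m) :
    objective K (M.bellman π (η N)) x ≤ objective K (M.bellman π (η (N + 1))) x := by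
  refine M.objective_bellman_le hmix hdisc π ?_
  set σ : MarkovPolicy S A m := fun i => πbar (N - 1 - i) with hσ
  set τ : MarkovPolicy S A m := fun i => Nat.casesOn i π σ with hτ
  -- the Markov policy `τ` plays `π` first and then `σ`, and is terminal at time `N + 1`
  have hterm : ∀ᵐ y ∂(M.step π x), ∀ᵐ z ∂(M.steps σ N y), M.IsTerminal z.1 := by
    have h1 := hN.ae_steps τ x le_rfl
    rw [M.steps_succ_eq_comp_step, Kernel.comp_apply] at h1
    exact Measure.ae_ae_of_ae_bind (Kernel.aemeasurable _) h1
  filter_upwards [hterm] with y hy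
  have h1 : objective K (M.iter σ N (η 0)).ker y = objective K (η N).ker y :=
    h.objective_iter_eq hmix hdisc (k := 0) (fun i _ => rfl) y
  have h2 : objective K (M.iter σ N (M.bellmanRet (σ N) (η 0))).ker y ≤
      objective K (η (N + 1)).ker y := h.objective_iter_le hmix hdisc σ (N + 1) 0 y
  rwa [objective_iter_eq_of_ae_terminal σ N (M.zeroAtTerminal_bellmanRet _ _) hy,
    ← objective_iter_eq_of_ae_terminal σ N h0 hy, h1] at h2

/-- Value iteration in an MDP of finite horizon. -/
theorem HasHorizon.valueIteration [StandardBorelSpace A] {N : ℕ} (hN : M.HasHorizon N)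
    (hmix : IndifferentToMixtures S K) (hdisc : IndifferentToDiscount M.γ K)
    {η : ℕ → RetDist S m} {πbar : ℕ → StatPolicy S A m} (h : ValueIteration M K η πbar)
    {n : ℕ} (hn : N ≤ n) :
    ((N < n ∨ M.ZeroAtTerminal (η 0)) → ∀ x : S × Vec m,
      IsLUB (range fun π : HistPolicy S A m => objective K (M.retDist π) x)
        (objective K (η n).ker x)) ∧
    ∀ x : S × Vec m,
      IsLUB (range fun π : HistPolicy S A m => objective K (M.retDist π) x)
        (objective K (M.retDist (πbar n).toHist) x) := by
  obtain ⟨⟨hN1, hT⟩, -⟩ := hN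
  have h' := h.bellmanRet hmix hdisc
  have h0' : M.ZeroAtTerminal (M.bellmanRet (πbar 0) (η 0)) := M.zeroAtTerminal_bellmanRet _ _
  have hopt : ∀ k, N ≤ k → ∀ x,
      IsLUB (range fun π : HistPolicy S A m => objective K (M.retDist π) x)
        (objective K (η (k + 1)).ker x) := fun k hk x => by
    rw [← h.greedy k x]
    exact hT.isLUB_objective hmix hdisc h' h0' hk x
  have hconst : ∀ k l, N ≤ k → N ≤ l → ∀ x,
      objective K (η (k + 1)).ker x = objective K (η (l + 1)).ker x := fun k l hk hl x =>
    (hopt k hk x).unique (hopt l hl x)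
  refine ⟨fun hcase x => ?_, fun x => ?_⟩
  · rcases hcase with hlt | h0
    · obtain ⟨k, rfl⟩ := Nat.exists_eq_succ_of_ne_zero (by omega : n ≠ 0)
      exact hopt k (by omega) x
    · exact hT.isLUB_objective hmix hdisc h h0 hn x
  · -- the Bellman operator of `πbar n` preserves the objective of `ζ`, which is optimal
    set ζ := M.bellmanRet (πbar n) (η n) with hζ
    have hval : ∀ y, objective K ζ.ker y = objective K (η (n + 1)).ker y := fun y => h.greedy n y
    have hfix : ∀ y, objective K (M.bellman (πbar n) ζ) y = objective K ζ.ker y := by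
      intro y
      refine le_antisymm ?_ ?_
      · rw [hval, hconst n (n + 1) hn (by omega) y, ← h.greedy (n + 1) y]
        exact h'.le n (πbar n) y
      · rcases hn.lt_or_eq with hlt | rfl
        · refine M.objective_bellman_le hmix hdisc (πbar n) (.of_forall fun z => ?_)
          obtain ⟨k, rfl⟩ := Nat.exists_eq_succ_of_ne_zero (by omega : n ≠ 0)
          rw [hval]
          exact (hconst k (k + 1) (by omega) (by omega) z).le
        · obtain ⟨k, rfl⟩ := Nat.exists_eq_succ_of_ne_zero (by omega : N ≠ 0)
          refine le_trans ?_
            (hT.le_objective_bellman_horizon hmix hdisc h' h0' (πbar (k + 1)) y)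
          exact M.objective_bellman_le hmix hdisc _ (.of_forall fun z => (h.greedy k z).ge)
    rw [hT.objective_stationary_eq hmix hdisc (πbar n) (M.zeroAtTerminal_bellmanRet _ _) hfix x,
      hval]
    exact hopt n hn x

end MDP

end FiniteHorizon

/-! ### Discounted value iteration -/

section DiscountedValueIteration

variable {S A : Type*} [MeasurableSpace S] [MeasurableSpace A] {m : ℕ}

theorem wass_le_moment_add (μ ν : Measure (Vec m)) [IsProbabilityMeasure μ]
    [IsProbabilityMeasure ν] : wass μ ν ≤ moment μ + moment ν := by
  refine (wass_triangle μ (Measure.dirac 0) ν).trans_eq ?_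
  rw [wass_comm _ ν, wass_dirac_zero, wass_dirac_zero]

theorem map_add_injective (c : Vec m) {μ ν : Measure (Vec m)}
    (h : (μ.map fun g => c + g) = ν.map fun g => c + g) : μ = ν := by
  have h1 := congrArg (Measure.map fun g => -c + g) h
  rw [Measure.map_map (by fun_prop) (by fun_prop), Measure.map_map (by fun_prop) (by fun_prop)]
    at h1
  simpa [Function.comp_def] using h1

theorem LipschitzFunctional.objective_le {X : Type*} {L : ℝ} {K : P1 m → ℝ}
    (hK : LipschitzFunctional L K)
    (hL : 0 ≤ L) {η η' : X × Vec m → Measure (Vec m)} {x : X × Vec m} (h : InP1 (η x))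
    (h' : InP1 (η' x)) {D : ℝ≥0∞} (hD : D ≠ ⊤) (hle : wass (η x) (η' x) ≤ D) :
    objective K η x ≤ objective K η' x + L * D.toReal := by
  rw [objective, objective, ev_of_inP1 (h.map_add x.2), ev_of_inP1 (h'.map_add x.2)]
  have h1 := (le_abs_self _).trans (hK ⟨_, h.map_add x.2⟩ ⟨_, h'.map_add x.2⟩)
  have h2 : (wass ((η x).map fun g => x.2 + g) ((η' x).map fun g => x.2 + g)).toReal ≤ D.toReal :=
    ENNReal.toReal_mono hD ((wass_map_add _ _ _).trans hle)
  have h3 := mul_le_mul_of_nonneg_left h2 hL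
  linarith

/-- A functional with a negative Lipschitz constant only exists when all distances vanish. -/
theorem LipschitzFunctional.wass_eq_zero {L : ℝ} {K : P1 m → ℝ} (hK : LipschitzFunctional L K)
    (hL : L < 0) {μ ν : Measure (Vec m)} (hμ : InP1 μ) (hν : InP1 ν) : wass μ ν = 0 := by
  have := hμ.1; have := hν.1
  have h1 := (abs_nonneg _).trans (hK ⟨μ, hμ⟩ ⟨ν, hν⟩)
  have hfin : wass μ ν ≠ ⊤ := ((wass_le_moment_add μ ν).trans_lt
    (ENNReal.add_lt_top.2 ⟨hμ.moment_lt_top, hν.moment_lt_top⟩)).ne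
  have h2 : (wass μ ν).toReal ≤ 0 := by
    by_contra hc
    exact absurd h1 (not_le.2 (mul_neg_of_neg_of_pos hL (not_le.1 hc)))
  exact ((ENNReal.toReal_eq_zero_iff _).1 (le_antisymm h2 ENNReal.toReal_nonneg)).resolve_right hfin

namespace MDP

variable {M : MDP S A m}

/-- The law of the `n`-step return under a history-based policy is an `n`-fold composition of
Bellman operators, applied along a Markov policy with the same laws of the augmented states. -/
theorem iter_zeroRet_eq (π : HistPolicy S A m) (x : S × Vec m) {σ : MarkovPolicy S A m} {n : ℕ}
    (hσ : (M.trajLaw π x).map (fun ω => stateAt x ω n) = M.steps σ n x) :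
    (M.iter σ n (zeroRet S m)).ker x =
      (M.trajLaw π x).map fun ω => ∑ t ∈ Finset.range n, M.γ ^ t • (ω t).2.1 := by
  refine map_add_injective x.2 ?_
  rw [← shift_apply, M.shift_iter_zeroRet, M.map_add_partialReturn, hσ]

theorem wass_iter_zeroRet_le (hγ : M.γ < 1) (π : HistPolicy S A m) (x : S × Vec m)
    {σ : MarkovPolicy S A m} {n : ℕ}
    (hσ : (M.trajLaw π x).map (fun ω => stateAt x ω n) = M.steps σ n x) :
    wass ((M.iter σ n (zeroRet S m)).ker x) (M.retDist π x) ≤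
      ENNReal.ofReal M.γ ^ n * M.returnBound := by
  rw [iter_zeroRet_eq π x hσ]
  exact M.wass_partialReturn_le π x hγ n

theorem moment_retDist_le (hγ : M.γ < 1) (π : HistPolicy S A m) (x : S × Vec m) :
    moment (M.retDist π x) ≤ M.returnBound := by
  have := M.isProbabilityMeasure_retDist π x hγ
  have h := M.wass_partialReturn_le π x hγ 0
  have h0 : ((M.trajLaw π x).map fun ω => ∑ t ∈ Finset.range 0, M.γ ^ t • (ω t).2.1) =
      Measure.dirac 0 := by simp [Measure.map_const]
  rwa [h0, wass_comm, wass_dirac_zero, pow_zero, one_mul] at h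

theorem inP1_retDist (hγ : M.γ < 1) (π : HistPolicy S A m) (x : S × Vec m) :
    InP1 (M.retDist π x) :=
  inP1_iff.2 ⟨M.isProbabilityMeasure_retDist π x hγ,
    (moment_retDist_le hγ π x).trans_lt (M.returnBound_lt_top hγ)⟩

theorem wassSup_retDist_lt_top (hγ : M.γ < 1) :
    (⨆ π : HistPolicy S A m, wassSup (M.retDist π) (zeroDist (S × Vec m) m)) < ⊤ := by
  refine (iSup_le fun π => iSup_le fun x => ?_).trans_lt (M.returnBound_lt_top hγ)
  have := M.isProbabilityMeasure_retDist π x hγ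
  rw [zeroDist, wass_dirac_zero]
  exact moment_retDist_le hγ π x

variable (M) in
/-- The largest distance of `ζ` from the return distributions of Markov policies. -/
noncomputable def returnGap (ζ : RetDist S m) : ℝ≥0∞ :=
  ⨆ π : MarkovPolicy S A m, wassSup ζ.ker (M.retDist π.toHist)

variable (M) in
/-- The largest distance of `ζ` from its images under Bellman operators. -/
noncomputable def bellmanGap (ζ : RetDist S m) : ℝ≥0∞ :=
  ⨆ π : StatPolicy S A m, wassSup (M.bellman π ζ) ζ.ker

theorem returnGap_lt_top (hγ : M.γ < 1) (ζ : RetDist S m) : M.returnGap ζ < ⊤ := by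
  refine (iSup_le fun π => iSup_le fun x => ?_).trans_lt
    (ENNReal.add_lt_top.2 ⟨ζ.bound_lt_top, M.returnBound_lt_top hγ⟩)
  have := M.isProbabilityMeasure_retDist π.toHist x hγ
  exact (wass_le_moment_add _ _).trans
    (add_le_add (ζ.moment_le x) (moment_retDist_le hγ _ x))

theorem bellmanGap_lt_top (ζ : RetDist S m) : M.bellmanGap ζ < ⊤ := by
  refine (iSup_le fun π => iSup_le fun x => ?_).trans_lt
    (ENNReal.add_lt_top.2 ⟨ENNReal.add_lt_top.2 ⟨M.rewardBound_lt_top,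
      ENNReal.mul_lt_top (ENNReal.ofReal_lt_top (r := M.γ)) ζ.bound_lt_top⟩, ζ.bound_lt_top⟩)
  exact (wass_le_moment_add _ _).trans
    (add_le_add (M.moment_bellman_le π ζ x) (ζ.moment_le x))

theorem wass_le_returnGap (ζ : RetDist S m) (σ : MarkovPolicy S A m) (y : S × Vec m) :
    wass (ζ.ker y) (M.retDist σ.toHist y) ≤ M.returnGap ζ :=
  (le_iSup (fun y => wass (ζ.ker y) (M.retDist σ.toHist y)) y).trans
    (le_iSup (fun π : MarkovPolicy S A m => wassSup ζ.ker (M.retDist π.toHist)) σ)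

theorem wass_le_bellmanGap (ζ : RetDist S m) (π : StatPolicy S A m) (y : S × Vec m) :
    wass (M.bellman π ζ y) (ζ.ker y) ≤ M.bellmanGap ζ :=
  (le_iSup (fun y => wass (M.bellman π ζ y) (ζ.ker y)) y).trans
    (le_iSup (fun π : StatPolicy S A m => wassSup (M.bellman π ζ) ζ.ker) π)

theorem tendsto_ofReal_γ_pow_mul (hγ : M.γ < 1) {C : ℝ≥0∞} (hC : C ≠ ⊤) :
    Filter.Tendsto (fun k => ENNReal.ofReal M.γ ^ k * C) Filter.atTop (nhds 0) := by
  have h := ENNReal.Tendsto.mul_const (b := C)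
    (ENNReal.tendsto_pow_atTop_nhds_zero_of_lt_one (r := ENNReal.ofReal M.γ) (by simpa using hγ))
    (Or.inr hC)
  rwa [zero_mul] at h

/-- Applying `n` Bellman operators to `ζ` approximates the return distribution up to the error
`γ ^ n` times the distance of `ζ` from the returns of the remaining Markov policies. Both sides
are compared with the `n + k`-step return, for `k → ∞`. -/
theorem wass_iter_retDist_le (hγ : M.γ < 1) (π : HistPolicy S A m) (x : S × Vec m)
    {σ : MarkovPolicy S A m}
    (hσ : ∀ n, (M.trajLaw π x).map (fun ω => stateAt x ω n) = M.steps σ n x) (n : ℕ)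
    (ζ : RetDist S m) :
    wass ((M.iter σ n ζ).ker x) (M.retDist π x) ≤ ENNReal.ofReal M.γ ^ n * M.returnGap ζ := by
  set c := ENNReal.ofReal M.γ
  have hk : ∀ k, wass ((M.iter σ n ζ).ker x) (M.retDist π x) ≤
      c ^ n * (M.returnGap ζ + c ^ k * M.returnBound) + c ^ n * (c ^ k * M.returnBound) := by
    intro k
    set τ : MarkovPolicy S A m := fun i => σ (n + i)
    have h1 : ∀ y, wass (ζ.ker y) ((M.iter τ k (zeroRet S m)).ker y) ≤
        M.returnGap ζ + c ^ k * M.returnBound := fun y => by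
      have := M.isProbabilityMeasure_retDist τ.toHist y hγ
      refine (wass_triangle _ (M.retDist τ.toHist y) _).trans
        (add_le_add (wass_le_returnGap ζ τ y) ?_)
      rw [wass_comm]
      exact wass_iter_zeroRet_le hγ τ.toHist y (M.map_stateAt_toHist y τ k)
    have h2 := M.wass_iter_le σ n h1 x
    have h3 := wass_iter_zeroRet_le hγ π x (hσ (n + k))
    rw [M.iter_add, pow_add, mul_assoc] at h3
    exact (wass_triangle _ ((M.iter σ n (M.iter τ k (zeroRet S m))).ker x) _).trans
      (add_le_add h2 h3)
  have hC := (M.returnBound_lt_top hγ).ne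
  have hcn : c ^ n ≠ ⊤ := ENNReal.pow_ne_top ENNReal.ofReal_ne_top
  have ht := tendsto_ofReal_γ_pow_mul (M := M) hγ hC
  have hlim := ((ENNReal.Tendsto.const_mul (a := c ^ n) (ht.const_add (M.returnGap ζ))
    (Or.inr hcn)).add (ENNReal.Tendsto.const_mul (a := c ^ n) ht (Or.inr hcn)))
  rw [add_zero, mul_zero, add_zero] at hlim
  exact ge_of_tendsto' hlim hk

variable {K : P1 m → ℝ} {L : ℝ}

theorem toReal_γ_pow_mul (n : ℕ) (D : ℝ≥0∞) :
    (ENNReal.ofReal M.γ ^ n * D).toReal = M.γ ^ n * D.toReal := by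
  rw [ENNReal.toReal_mul, ENNReal.toReal_pow, ENNReal.toReal_ofReal M.γ_pos.le]

theorem γ_pow_mul_ne_top (n : ℕ) {D : ℝ≥0∞} (hD : D ≠ ⊤) : ENNReal.ofReal M.γ ^ n * D ≠ ⊤ :=
  ENNReal.mul_ne_top (ENNReal.pow_ne_top ENNReal.ofReal_ne_top) hD

/-- The error of the `n`-th iterate. -/
theorem objective_retDist_le [StandardBorelSpace A] (hγ : M.γ < 1)
    (hK : LipschitzFunctional L K) (hL : 0 ≤ L)
    (hmix : IndifferentToMixtures S K) (hdisc : IndifferentToDiscount M.γ K)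
    {η : ℕ → RetDist S m} {πbar : ℕ → StatPolicy S A m} (h : ValueIteration M K η πbar)
    (π : HistPolicy S A m) (n : ℕ) (x : S × Vec m) :
    objective K (M.retDist π) x ≤
      objective K (η n).ker x + L * (M.γ ^ n * (M.returnGap (η 0)).toReal) := by
  obtain ⟨σ, hσ⟩ := M.exists_markovPolicy_map_stateAt_eq π x
  have h1 := hK.objective_le hL (η := M.retDist π) (η' := (M.iter σ n (η 0)).ker) (x := x)
    (inP1_retDist hγ π x) ((M.iter σ n (η 0)).inP1 x)
    (γ_pow_mul_ne_top (M := M) n (returnGap_lt_top hγ (η 0)).ne)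
    (by rw [wass_comm]; exact wass_iter_retDist_le hγ π x hσ n (η 0))
  rw [toReal_γ_pow_mul] at h1
  have h2 := h.objective_iter_le hmix hdisc σ n 0 x
  rw [add_zero] at h2
  linarith

/-- Applying the greedy Bellman operator once more to `T ^ k (η n)` decreases the objective by at
most `L γ ^ (n + k)` times the Bellman gap of `η 0`: both terms compare with the result of applying
`n + k` operators to `η 0` and to one of its Bellman images. -/
theorem objective_iter_greedy_le (hK : LipschitzFunctional L K) (hL : 0 ≤ L)
    (hmix : IndifferentToMixtures S K) (hdisc : IndifferentToDiscount M.γ K)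
    {η : ℕ → RetDist S m} {πbar : ℕ → StatPolicy S A m} (h : ValueIteration M K η πbar)
    (n k : ℕ) (x : S × Vec m) :
    objective K (M.iter (fun _ => πbar n) k (η n)).ker x ≤
      objective K (M.iter (fun _ => πbar n) (k + 1) (η n)).ker x +
        L * (M.γ ^ (n + k) * (M.bellmanGap (η 0)).toReal) := by
  set τ : MarkovPolicy S A m := fun _ => πbar n
  set σ : MarkovPolicy S A m := fun i => πbar (n - 1 - i)
  have h1 : objective K (M.iter τ k (M.iter σ n (η 0))).ker x =
      objective K (M.iter τ k (η n)).ker x :=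
    M.objective_iter_congr hmix hdisc τ k (fun y =>
      h.objective_iter_eq hmix hdisc (k := 0) (fun i _ => rfl) y) x
  have h2 : objective K (M.iter τ k (M.iter σ n (M.bellmanRet (πbar 0) (η 0)))).ker x ≤
      objective K (M.iter τ (k + 1) (η n)).ker x := by
    refine M.objective_iter_le hmix hdisc τ k (fun y => ?_) x
    calc objective K (M.iter σ n (M.bellmanRet (πbar 0) (η 0))).ker y
        ≤ objective K (M.iter σ n (η 1)).ker y :=
          M.objective_iter_le hmix hdisc σ n (h.le 0 (πbar 0)) y
      _ ≤ objective K (η (n + 1)).ker y := h.objective_iter_le hmix hdisc σ n 1 y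
      _ = objective K (M.bellmanRet (τ k) (η n)).ker y := (h.greedy n y).symm
  have h3 := hK.objective_le hL (η := (M.iter τ k (M.iter σ n (η 0))).ker)
    (η' := (M.iter τ k (M.iter σ n (M.bellmanRet (πbar 0) (η 0)))).ker) (x := x)
    (RetDist.inP1 _ x) (RetDist.inP1 _ x)
    (γ_pow_mul_ne_top (M := M) k (γ_pow_mul_ne_top (M := M) n (bellmanGap_lt_top (η 0)).ne))
    (M.wass_iter_le τ k (M.wass_iter_le σ n fun y => by
      rw [wass_comm]; exact wass_le_bellmanGap (η 0) (πbar 0) y) x)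
  rw [toReal_γ_pow_mul, toReal_γ_pow_mul, ← mul_assoc (M.γ ^ k), ← pow_add, add_comm k n] at h3
  linarith

/-- The loss of the stationary greedy policy relative to the iterate it was computed from. -/
theorem objective_le_objective_greedy (hγ : M.γ < 1)
    (hK : LipschitzFunctional L K) (hL : 0 ≤ L)
    (hmix : IndifferentToMixtures S K) (hdisc : IndifferentToDiscount M.γ K)
    {η : ℕ → RetDist S m} {πbar : ℕ → StatPolicy S A m} (h : ValueIteration M K η πbar)
    (n : ℕ) (x : S × Vec m) :
    objective K (η n).ker x ≤ objective K (M.retDist (πbar n).toHist) x +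
      L * M.γ ^ n * (1 / (1 - M.γ) * (M.bellmanGap (η 0)).toReal) := by
  set τ : MarkovPolicy S A m := fun _ => πbar n with hτ
  set D := (M.bellmanGap (η 0)).toReal
  set E := (M.returnGap (η n)).toReal
  have hD : 0 ≤ D := ENNReal.toReal_nonneg
  have hγ0 := M.γ_pos
  have hsum : ∀ k, objective K (η n).ker x ≤ objective K (M.iter τ k (η n)).ker x +
      L * M.γ ^ n * (∑ j ∈ Finset.range k, M.γ ^ j) * D := fun k => by
    induction k with
    | zero => simp [iter]
    | succ k ih =>
      have := objective_iter_greedy_le hK hL hmix hdisc h n k x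
      rw [Finset.sum_range_succ]
      refine ih.trans ((add_le_add_left this _).trans_eq ?_)
      rw [pow_add]
      ring
  have hk : ∀ k, objective K (η n).ker x ≤ objective K (M.retDist (πbar n).toHist) x +
      L * M.γ ^ n * (1 / (1 - M.γ) * D) + L * (M.γ ^ k * E) := fun k => by
    have h1 := hK.objective_le hL (η := (M.iter τ k (η n)).ker)
      (η' := M.retDist (πbar n).toHist) (x := x)
      (RetDist.inP1 _ x) (inP1_retDist hγ _ x)
      (γ_pow_mul_ne_top (M := M) k (returnGap_lt_top hγ (η n)).ne)
      (wass_iter_retDist_le hγ (πbar n).toHist x (fun j => M.map_stateAt_toHist x τ j) k (η n))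
    rw [toReal_γ_pow_mul] at h1
    have h2 : ∑ j ∈ Finset.range k, M.γ ^ j ≤ 1 / (1 - M.γ) := by
      rw [one_div, ← tsum_geometric_of_lt_one hγ0.le hγ]
      exact (summable_geometric_of_lt_one hγ0.le hγ).sum_le_tsum _ fun j _ => by positivity
    have h3 : L * M.γ ^ n * (∑ j ∈ Finset.range k, M.γ ^ j) * D ≤
        L * M.γ ^ n * (1 / (1 - M.γ) * D) := by
      rw [mul_assoc (L * M.γ ^ n)]
      gcongr
    have := hsum k
    linarith
  have hlim : Filter.Tendsto (fun k => objective K (M.retDist (πbar n).toHist) x +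
      L * M.γ ^ n * (1 / (1 - M.γ) * D) + L * (M.γ ^ k * E)) Filter.atTop
      (nhds (objective K (M.retDist (πbar n).toHist) x +
        L * M.γ ^ n * (1 / (1 - M.γ) * D) + L * (0 * E))) :=
    (((tendsto_pow_atTop_nhds_zero_of_lt_one hγ0.le hγ).mul_const E).const_mul L).const_add _
  have := ge_of_tendsto' hlim hk
  simpa using this

theorem discounted_valueIteration [StandardBorelSpace A] (hγ : M.γ < 1)
    (hK : LipschitzFunctional L K)
    (hmix : IndifferentToMixtures S K) (hdisc : IndifferentToDiscount M.γ K)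
    {η : ℕ → RetDist S m} {πbar : ℕ → StatPolicy S A m} (h : ValueIteration M K η πbar)
    (n : ℕ) (x : S × Vec m) :
    BddAbove (range fun π : HistPolicy S A m => objective K (M.retDist π) x) ∧
    (⨆ π : HistPolicy S A m, objective K (M.retDist π) x) - objective K (η n).ker x ≤
      L * M.γ ^ n * (M.returnGap (η 0)).toReal ∧
    (⨆ π : HistPolicy S A m, objective K (M.retDist π) x) -
        objective K (M.retDist (πbar n).toHist) x ≤
      L * M.γ ^ n * (1 / (1 - M.γ) * (M.bellmanGap (η 0)).toReal +
        (M.returnGap (η 0)).toReal) := by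
  wlog hL : 0 ≤ L generalizing L
  · -- a negative constant may be replaced by zero, and both gaps vanish
    have hL' : L < 0 := not_le.1 hL
    have h0 := this (L := 0) (fun ν ν' => (hK ν ν').trans
      (mul_le_mul_of_nonneg_right hL'.le ENNReal.toReal_nonneg)) le_rfl
    have hr : M.returnGap (η 0) = 0 := by
      simp only [returnGap, wassSup, ENNReal.iSup_eq_zero]
      exact fun π y => hK.wass_eq_zero hL' ((η 0).inP1 y) (inP1_retDist hγ _ y)
    have hb : M.bellmanGap (η 0) = 0 := by
      simp only [bellmanGap, wassSup, ENNReal.iSup_eq_zero]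
      exact fun π y => hK.wass_eq_zero hL' ((M.bellmanRet π (η 0)).inP1 y) ((η 0).inP1 y)
    rw [hr, hb] at h0 ⊢
    simpa using h0
  have hne : Nonempty (HistPolicy S A m) := ⟨(πbar 0).toHist⟩
  have h1 : (⨆ π : HistPolicy S A m, objective K (M.retDist π) x) ≤
      objective K (η n).ker x + L * (M.γ ^ n * (M.returnGap (η 0)).toReal) :=
    ciSup_le fun π => objective_retDist_le hγ hK hL hmix hdisc h π n x
  have h2 := objective_le_objective_greedy hγ hK hL hmix hdisc h n x
  refine ⟨⟨_, forall_mem_range.2 fun π =>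
    objective_retDist_le hγ hK hL hmix hdisc h π n x⟩, by linarith, ?_⟩
  rw [mul_add]
  linarith

end MDP

end DiscountedValueIteration

end DistDP

theorem mainTheorem1 {S A : Type*} [MeasurableSpace S] [Finite A] [MeasurableSpace A]
    [MeasurableSingletonClass A] {m : ℕ} (M : DistDP.MDP S A m) (K : DistDP.P1 m → ℝ)
    (hmix : DistDP.IndifferentToMixtures S K) (hdisc : DistDP.IndifferentToDiscount M.γ K)
    (η : ℕ → DistDP.RetDist S m) (πbar : ℕ → DistDP.StatPolicy S A m)
    (hiter : ∀ (n : ℕ) (x : S × DistDP.Vec m),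
      IsLUB (range fun π : DistDP.StatPolicy S A m => DistDP.objective K (M.bellman π (η n)) x)
        (DistDP.objective K (η (n + 1)).ker x))
    (hgreedy : ∀ (n : ℕ) (x : S × DistDP.Vec m),
      IsLUB (range fun π : DistDP.StatPolicy S A m => DistDP.objective K (M.bellman π (η n)) x)
        (DistDP.objective K (M.bellman (πbar n) (η n)) x)) :
    (∀ N : ℕ, M.HasHorizon N →
      (⨆ π : DistDP.HistPolicy S A m,
        DistDP.wassSup (M.retDist π) (DistDP.zeroDist (S × DistDP.Vec m) m)) < ⊤ ∧
      ∀ n : ℕ, N ≤ n →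
        ((N < n ∨ ∀ (s : S) (c : DistDP.Vec m), M.IsTerminal s →
            (η 0).ker (s, c) = Measure.dirac 0) →
          ∀ x : S × DistDP.Vec m,
            IsLUB (range fun π : DistDP.HistPolicy S A m => DistDP.objective K (M.retDist π) x)
              (DistDP.objective K (η n).ker x)) ∧
        ∀ x : S × DistDP.Vec m,
          IsLUB (range fun π : DistDP.HistPolicy S A m => DistDP.objective K (M.retDist π) x)
            (DistDP.objective K (M.retDist (πbar n).toHist) x)) ∧
    (M.γ < 1 → ∀ L : ℝ, DistDP.LipschitzFunctional L K →
      (⨆ π : DistDP.HistPolicy S A m,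
        DistDP.wassSup (M.retDist π) (DistDP.zeroDist (S × DistDP.Vec m) m)) < ⊤ ∧
      (⨆ π : DistDP.MarkovPolicy S A m,
        DistDP.wassSup (η 0).ker (M.retDist π.toHist)) < ⊤ ∧
      (⨆ π : DistDP.StatPolicy S A m,
        DistDP.wassSup (M.bellman π (η 0)) (η 0).ker) < ⊤ ∧
      ∀ (n : ℕ) (x : S × DistDP.Vec m),
        BddAbove (range fun π : DistDP.HistPolicy S A m => DistDP.objective K (M.retDist π) x) ∧
        (⨆ π : DistDP.HistPolicy S A m, DistDP.objective K (M.retDist π) x)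
            - DistDP.objective K (η n).ker x
          ≤ L * M.γ ^ n *
            (⨆ π : DistDP.MarkovPolicy S A m,
              DistDP.wassSup (η 0).ker (M.retDist π.toHist)).toReal ∧
        (⨆ π : DistDP.HistPolicy S A m, DistDP.objective K (M.retDist π) x)
            - DistDP.objective K (M.retDist (πbar n).toHist) x
          ≤ L * M.γ ^ n *
            (1 / (1 - M.γ) *
                (⨆ π : DistDP.StatPolicy S A m,
                  DistDP.wassSup (M.bellman π (η 0)) (η 0).ker).toReal +
              (⨆ π : DistDP.MarkovPolicy S A m,
                DistDP.wassSup (η 0).ker (M.retDist π.toHist)).toReal)) := by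
  have hV : DistDP.ValueIteration M K η πbar :=
    ⟨fun n π x => (hiter n x).1 ⟨π, rfl⟩, fun n x => (hgreedy n x).unique (hiter n x)⟩
  refine ⟨fun N hN => ⟨hN.1.2.wassSup_retDist_lt_top, fun n hn =>
    hN.valueIteration hmix hdisc hV hn⟩, fun hγ L hK => ⟨DistDP.MDP.wassSup_retDist_lt_top hγ,
    DistDP.MDP.returnGap_lt_top hγ _, DistDP.MDP.bellmanGap_lt_top _, fun n x =>
    DistDP.MDP.discounted_valueIteration hγ hK hmix hdisc hV n x⟩⟩
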